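/- The fillable array problem asks to maintain an array $A$ of $n\ge 1$ entries of $w$ bits, indexed by $[n]$, under $\mathrm{write}(i,\Delta)$ ($A[i]\leftarrow\Delta$), $\mathrm{fill}(\Delta)$ ($A[i]\leftarrow\Delta$ for all $i$) and $\mathrm{read}(i)$ (return $A[i]$; the answer is arbitrary if $A[i]$ was never set). The model is the word RAM with word size $w\ge\log_2 n$, with $O(1)$ working registers that do not persist between operations. A random permutation $F$ of $[n]$ with distribution $\mu$ (for example the uniform distribution on a family $\Pi$ of permutations) is $\delta$-almost pairwise independent if for all distinct $x_1,x_2\in[n]$ the distribution of $(F(x_1),F(x_2))$ has variation distance $\frac12\sum_\omega|D_1(\omega)-D_2(\omega)|$ at most $\delta$ from the uniform distribution on pairs of distinct elements of $[n]$. Theorem. There are a data structure for the fillable array problem and an absolute constant $K$ such that the following holds for all $n\ge 1$ and $w\ge \log_2 n$. The data structure uses exactly $nw+1$ bits of memory (one bit of redundancy), whose initial contents are arbitrary, and it has oracle access to a permutation $F$ of $[n]$, where one evaluation of $F$ costs one time step. For every sequence of operations and every permutation $F$: the initialization takes time at most $K$, every operation terminates, every read of an entry that has been set returns its current value, and every read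 and every fill takes time at most $K$ in the worst case. If moreover $F$ is drawn (independently of the sequence of operations) from a $1/n^2$-almost pairwise independent distribution of permutations of $[n]$, then each write in the sequence takes expected time at most $K$. Thus this is a Las Vegas randomized fillable array with one bit of redundancy, worst-case $O(1)$ read and fill, and expected $O(1)$ time for each write. -/

import Mathlib

namespace FillableArray

/-! ### The fillable array problem -/

/-- The operations on an array of `n` entries of `w` bits. Entries are indexed by `0, …, n - 1`. -/
inductive Op (n w : ℕ) where
  | read (i : Fin n)
  | write (i : Fin n) (Δ : BitVec w)
  | fill (Δ : BitVec w)

/-- The operation is a `write`. -/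
def Op.IsWrite {n w : ℕ} : Op n w → Prop
  | .write _ _ => True
  | _ => False

/-- The effect of one operation on the abstract array `A`; `none` means that the entry has never
been set. -/
def Op.apply {n w : ℕ} (A : Fin n → Option (BitVec w)) : Op n w → (Fin n → Option (BitVec w))
  | .read _ => A
  | .write i Δ => Function.update A i (some Δ)
  | .fill Δ => fun _ => some Δ

/-- The abstract array after a sequence of operations, starting with no entry set. -/
def contents {n w : ℕ} (ops : List (Op n w)) : Fin n → Option (BitVec w) :=
  ops.foldl Op.apply (fun _ => none)

/-! ### A word RAM with word size `w`, an oracle for a permutation, and `n * w + 1` bits of memory -/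

/-- The memory of the data structure: `n` cells of `w` bits and one more bit. This is all that
survives from one operation to the next. -/
structure Store (n w : ℕ) where
  cells : Fin n → BitVec w
  bit : Bool

/-- The configuration of the machine during an operation: the memory together with registers of
`w` bits. A program mentions finitely many registers, by fixed numbers. -/
structure Config (n w : ℕ) where
  regs : ℕ → BitVec w
  store : Store n w

/-- Operations on words, all modulo `2 ^ w` and unsigned. -/
inductive ArithOp where
  | add | sub | mul | div | mod | and | or | xor | shl | shr

/-- The result of a word operation (quotient by zero is zero, remainder by zero is the
dividend). -/
def ArithOp.eval {w : ℕ} : ArithOp → BitVec w → BitVec w → BitVec w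
  | .add, x, y => x + y
  | .sub, x, y => x - y
  | .mul, x, y => x * y
  | .div, x, y => x / y
  | .mod, x, y => x % y
  | .and, x, y => x &&& y
  | .or, x, y => x ||| y
  | .xor, x, y => x ^^^ y
  | .shl, x, y => x <<< y
  | .shr, x, y => x >>> y

/-- The instructions of the machine; all arguments are register numbers, except the constant `c`
in `const` and the bit `b` in `setBit`. -/
inductive Instr where
  /-- `R[d] ← c mod 2 ^ w` -/
  | const (d c : ℕ)
  /-- `R[d] ← R[a]` -/
  | move (d a : ℕ)
  /-- `R[d] ← R[a] o R[b]` -/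
  | arith (o : ArithOp) (d a b : ℕ)
  /-- `R[d] ← cells[R[a]]` (zero when there is no such cell) -/
  | load (d a : ℕ)
  /-- `cells[R[a]] ← R[b]` (no effect when there is no such cell) -/
  | store (a b : ℕ)
  /-- set the extra bit to `b` -/
  | setBit (b : Bool)
  /-- oracle call `R[d] ← F(R[a])` (zero when `R[a]` is not an index) -/
  | oracle (d a : ℕ)

/-- Write a value into a register. -/
def Config.setReg {n w : ℕ} (c : Config n w) (d : ℕ) (v : BitVec w) : Config n w :=
  { c with regs := Function.update c.regs d v }

/-- The effect of one instruction, with oracle `F`. -/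
def Instr.exec {n w : ℕ} (F : Equiv.Perm (Fin n)) (c : Config n w) : Instr → Config n w
  | .const d k => c.setReg d (BitVec.ofNat w k)
  | .move d a => c.setReg d (c.regs a)
  | .arith o d a b => c.setReg d (o.eval (c.regs a) (c.regs b))
  | .load d a =>
      c.setReg d (if h : (c.regs a).toNat < n then c.store.cells ⟨(c.regs a).toNat, h⟩ else 0)
  | .store a b =>
      if h : (c.regs a).toNat < n then
        { c with store := { c.store with
            cells := Function.update c.store.cells ⟨(c.regs a).toNat, h⟩ (c.regs b) } }
      else c
  | .setBit b => { c with store := { c.store with bit := b } }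
  | .oracle d a =>
      c.setReg d
        (if h : (c.regs a).toNat < n then BitVec.ofNat w (F ⟨(c.regs a).toNat, h⟩).val else 0)

/-- Tests: equality or order of the contents of two registers, or whether the extra bit is set. -/
inductive Test where
  | eq (a b : ℕ)
  | lt (a b : ℕ)
  | bit

/-- The value of a test. -/
def Test.Holds {n w : ℕ} (c : Config n w) : Test → Prop
  | .eq a b => c.regs a = c.regs b
  | .lt a b => (c.regs a).toNat < (c.regs b).toNat
  | .bit => c.store.bit = true

/-- Word RAM programs. -/
inductive Prog where
  | skip
  | instr (i : Instr)
  | seq (p q : Prog)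
  | ite (b : Test) (p q : Prog)
  | loop (b : Test) (p : Prog)

/-- `Exec F p c t c'`: started in `c` with oracle `F`, the program `p` halts in `c'` after exactly
`t` time steps. Each instruction (an oracle call in particular) and each evaluation of a test takes
one step. -/
inductive Exec {n w : ℕ} (F : Equiv.Perm (Fin n)) :
    Prog → Config n w → ℕ → Config n w → Prop where
  | skip (c) : Exec F .skip c 0 c
  | instr (i c) : Exec F (.instr i) c 1 (i.exec F c)
  | seq {p q c₁ c₂ c₃ s t} : Exec F p c₁ s c₂ → Exec F q c₂ t c₃ →
      Exec F (.seq p q) c₁ (s + t) c₃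
  | ite_true {b p q c c' t} : b.Holds c → Exec F p c t c' → Exec F (.ite b p q) c (t + 1) c'
  | ite_false {b p q c c' t} : ¬ b.Holds c → Exec F q c t c' → Exec F (.ite b p q) c (t + 1) c'
  | loop_true {b p c₁ c₂ c₃ s t} : b.Holds c₁ → Exec F p c₁ s c₂ → Exec F (.loop b p) c₂ t c₃ →
      Exec F (.loop b p) c₁ (s + t + 1) c₃
  | loop_false {b p c} : ¬ b.Holds c → Exec F (.loop b p) c 1 c

/-- The machine is deterministic: the running time and the final configuration are determined by
the oracle, the program and the initial configuration. -/
theorem Exec.unique {n w : ℕ} {F : Equiv.Perm (Fin n)} {p : Prog} {c c₁ c₂ : Config n w}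
    {t₁ t₂ : ℕ} (h₁ : Exec F p c t₁ c₁) (h₂ : Exec F p c t₂ c₂) : t₁ = t₂ ∧ c₁ = c₂ := by
  induction h₁ generalizing t₂ c₂ with
  | skip c => cases h₂; exact ⟨rfl, rfl⟩
  | instr i c => cases h₂; exact ⟨rfl, rfl⟩
  | seq _ _ ih₁ ih₂ =>
    cases h₂ with
    | seq g₁ g₂ =>
      obtain ⟨rfl, rfl⟩ := ih₁ g₁
      obtain ⟨rfl, rfl⟩ := ih₂ g₂
      exact ⟨rfl, rfl⟩
  | ite_true hb _ ih =>
    cases h₂ with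
    | ite_true _ g => obtain ⟨rfl, rfl⟩ := ih g; exact ⟨rfl, rfl⟩
    | ite_false hb' _ => exact absurd hb hb'
  | ite_false hb _ ih =>
    cases h₂ with
    | ite_true hb' _ => exact absurd hb' hb
    | ite_false _ g => obtain ⟨rfl, rfl⟩ := ih g; exact ⟨rfl, rfl⟩
  | loop_true hb _ _ ih₁ ih₂ =>
    cases h₂ with
    | loop_true _ g₁ g₂ =>
      obtain ⟨rfl, rfl⟩ := ih₁ g₁
      obtain ⟨rfl, rfl⟩ := ih₂ g₂
      exact ⟨rfl, rfl⟩
    | loop_false hb' => exact absurd hb hb'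
  | loop_false hb =>
    cases h₂ with
    | loop_true hb' _ _ => exact absurd hb' hb
    | loop_false _ => exact ⟨rfl, rfl⟩

/-! ### Implementations of fillable arrays and their runs -/

/-- An implementation: one program for the initialization and one for each kind of operation.
The programs do not depend on `n` and `w`. -/
structure Implementation where
  setup : Prog
  read : Prog
  write : Prog
  fill : Prog

/-- The program that serves an operation. -/
def Implementation.prog {n w : ℕ} (D : Implementation) : Op n w → Prog
  | .read _ => D.read
  | .write _ _ => D.write
  | .fill _ => D.fill

/-- The registers at the start: register `0` holds the last index `n - 1`, registers `1` and `2`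
hold the arguments, all others are zero. -/
def startRegs (n w : ℕ) (x y : BitVec w) : ℕ → BitVec w
  | 0 => BitVec.ofNat w (n - 1)
  | 1 => x
  | 2 => y
  | _ => 0

/-- The registers at the start of an operation: the index goes to register `1`, the value to
register `2`. -/
def Op.startRegs {n w : ℕ} : Op n w → (ℕ → BitVec w)
  | .read i => FillableArray.startRegs n w (BitVec.ofNat w i.val) 0
  | .write i Δ => FillableArray.startRegs n w (BitVec.ofNat w i.val) Δ
  | .fill Δ => FillableArray.startRegs n w 0 Δ

/-- A record of a run on a sequence of operations: the time of the initialization and, for the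
operation in position `j` (counted from `0`), the memory before it, its running time and its
answer. -/
structure Run (n w : ℕ) where
  setupTime : ℕ
  store : ℕ → Store n w
  time : ℕ → ℕ
  answer : ℕ → BitVec w

/-- `ρ` records what happens when `D` with oracle `F` is initialized on a memory with contents `m₀`
and then performs the operations `ops` one after the other; in particular every operation halts.
The answer to an operation is found in register `0`. -/
structure Run.IsRunOf {n w : ℕ} (ρ : Run n w) (D : Implementation) (F : Equiv.Perm (Fin n))
    (m₀ : Store n w) (ops : List (Op n w)) : Prop where
  setup : ∃ c : Config n w, Exec F D.setup ⟨startRegs n w 0 0, m₀⟩ ρ.setupTime c ∧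
    c.store = ρ.store 0
  step : ∀ (j : ℕ) (hj : j < ops.length), ∃ c : Config n w,
    Exec F (D.prog ops[j]) ⟨ops[j].startRegs, ρ.store j⟩ (ρ.time j) c ∧
      c.store = ρ.store (j + 1) ∧ c.regs 0 = ρ.answer j

/-- Every `read` of an entry that has been set returns the current value of that entry. (The answer
for an entry that has never been set is arbitrary.) -/
def Run.Correct {n w : ℕ} (ρ : Run n w) (ops : List (Op n w)) : Prop :=
  ∀ (j : ℕ) (hj : j < ops.length) (i : Fin n) (v : BitVec w),
    ops[j] = .read i → contents (ops.take j) i = some v → ρ.answer j = v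

/-! ### Almost `k`-wise independent permutations -/

/-- The variation distance of two distributions on a finite set. -/
noncomputable def variationDistance {Ω : Type*} [Fintype Ω] (D₁ D₂ : PMF Ω) : ℝ :=
  1 / 2 * ∑ ω, |(D₁ ω).toReal - (D₂ ω).toReal|

/-- A random permutation of an `n`-element set with distribution `μ` is `δ`-almost `k`-wise
independent: for every `k`-tuple `x` of distinct elements, the distribution of
`(F (x 1), …, F (x k))` is `δ`-close to the uniform distribution on the set of all `k`-tuples of
distinct elements. For a family `Π` of permutations, `μ` is the uniform distribution on `Π`. -/
def IsAlmostKWiseIndependent {n : ℕ} (k : ℕ) (δ : ℝ) (μ : PMF (Equiv.Perm (Fin n))) : Prop :=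
  ∀ x : Fin k ↪ Fin n,
    variationDistance (μ.map fun F => x.trans F.toEmbedding)
      (@PMF.uniformOfFintype (Fin k ↪ Fin n) _ ⟨x⟩) ≤ δ

end FillableArray

/-! The data structure is deterministic and serves every operation in constant worst-case time, so
the expected time of a write is an average of quantities below one constant. The difficulty is to
support `fill` with one extra bit.

Cut the array into `M = (n - 1) / 4` blocks of four cells and keep a border `b`. Exactly `b` blocks
are active, that is, stored explicitly: each block below the border either holds its own contents,
or lends its space to one active block above the border, and then the two point to each other
(`Linked`). Inactive blocks have the value of the last fill throughout. A linked pair has eight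
cells: two pointers, the four entries of the upper block, and two spare cells. As long as `b < M`
the last block is linked, and its spare cells record `b` and the fill value (`Header`). The extra
bit marks `b = M`, where every entry is in place.

Data written into the pointer cell of a block at home may mimic a link. The upper block concerned is
unlinked, so its cells store nothing and it can be turned to point to itself; this is `storeFix`,
which leaves the links unchanged (`linked_storeFix`, `Repr.storeFix`).

A write to an inactive block needs room for one more block. Moving the border up by one
(`Repr.bump`, `wp_absorb`) yields a block at home that holds only the fill value, and relinking
(`Repr.link`, `wp_activate`) gives its space to the block to be written. For `M ≥ 2` a fill sets `b
= 1` and links block `0` to the last block (`represents_filled`); for smaller `M` it overwrites all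
cells.

All code is loop-free. It is verified over natural numbers by `Code.wp`, and `Code.exec_of_wp`
carries the result to the machine. -/

namespace FillableArray

/-! ### Loop-free code and its weakest preconditions over natural numbers -/

/-- Loop-free programs for the word RAM that use only some of its instructions. -/
inductive Code where
  | skip
  | const (d k : ℕ)
  | move (d a : ℕ)
  | add (d a b : ℕ)
  | sub (d a b : ℕ)
  | div (d a b : ℕ)
  | mod (d a b : ℕ)
  | load (d a : ℕ)
  | store (a b : ℕ)
  | setBit (b : Bool)
  | seq (p q : Code)
  | ite (t : Test) (p q : Code)

/-- Sequential composition. -/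
infixr:60 " ;; " => Code.seq

/-- The word RAM program of a piece of loop-free code. -/
def Code.compile : Code → Prog
  | .skip => .skip
  | .const d k => .instr (.const d k)
  | .move d a => .instr (.move d a)
  | .add d a b => .instr (.arith .add d a b)
  | .sub d a b => .instr (.arith .sub d a b)
  | .div d a b => .instr (.arith .div d a b)
  | .mod d a b => .instr (.arith .mod d a b)
  | .load d a => .instr (.load d a)
  | .store a b => .instr (.store a b)
  | .setBit b => .instr (.setBit b)
  | .seq p q => .seq p.compile q.compile
  | .ite t p q => .ite t p.compile q.compile

/-- An upper bound for the running time of loop-free code. -/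
def Code.cost : Code → ℕ
  | .skip => 0
  | .seq p q => p.cost + q.cost
  | .ite _ p q => max p.cost q.cost + 1
  | _ => 1

/-- Configurations of the machine with words read as natural numbers. -/
@[ext] structure State where
  reg : ℕ → ℕ
  mem : ℕ → ℕ
  bit : Bool

/-- Write a register. -/
def State.set (σ : State) (d v : ℕ) : State := { σ with reg := Function.update σ.reg d v }

/-- Write a memory cell. -/
def State.put (σ : State) (a v : ℕ) : State := { σ with mem := Function.update σ.mem a v }

/-- Write the extra bit. -/
def State.mark (σ : State) (b : Bool) : State := { σ with bit := b }

@[simp] theorem State.set_reg (σ : State) (d v k : ℕ) :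
    (σ.set d v).reg k = if k = d then v else σ.reg k := by
  simp [State.set, Function.update_apply]
@[simp] theorem State.set_mem (σ : State) (d v : ℕ) : (σ.set d v).mem = σ.mem := rfl
@[simp] theorem State.set_bit (σ : State) (d v : ℕ) : (σ.set d v).bit = σ.bit := rfl
@[simp] theorem State.put_reg (σ : State) (a v : ℕ) : (σ.put a v).reg = σ.reg := rfl
@[simp] theorem State.put_mem (σ : State) (a v : ℕ) :
    (σ.put a v).mem = Function.update σ.mem a v := rfl
@[simp] theorem State.put_bit (σ : State) (a v : ℕ) : (σ.put a v).bit = σ.bit := rfl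
@[simp] theorem State.mark_reg (σ : State) (b : Bool) : (σ.mark b).reg = σ.reg := rfl
@[simp] theorem State.mark_mem (σ : State) (b : Bool) : (σ.mark b).mem = σ.mem := rfl
@[simp] theorem State.mark_bit (σ : State) (b : Bool) : (σ.mark b).bit = b := rfl

/-- The value of a test. -/
def Test.HoldsIn (σ : State) : Test → Prop
  | .eq a b => σ.reg a = σ.reg b
  | .lt a b => σ.reg a < σ.reg b
  | .bit => σ.bit = true

/-- A precondition under which code runs without overflow and without accesses outside of the
`n` cells, and ends in a state that satisfies `Q`; words are smaller than `W`. -/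
def Code.wp (n W : ℕ) : Code → (State → Prop) → State → Prop
  | .skip, Q, σ => Q σ
  | .const d k, Q, σ => Q (σ.set d (k % W))
  | .move d a, Q, σ => Q (σ.set d (σ.reg a))
  | .add d a b, Q, σ => σ.reg a + σ.reg b < W ∧ Q (σ.set d (σ.reg a + σ.reg b))
  | .sub d a b, Q, σ => σ.reg b ≤ σ.reg a ∧ Q (σ.set d (σ.reg a - σ.reg b))
  | .div d a b, Q, σ => Q (σ.set d (σ.reg a / σ.reg b))
  | .mod d a b, Q, σ => Q (σ.set d (σ.reg a % σ.reg b))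
  | .load d a, Q, σ => σ.reg a < n ∧ Q (σ.set d (σ.mem (σ.reg a)))
  | .store a b, Q, σ => σ.reg a < n ∧ Q (σ.put (σ.reg a) (σ.reg b))
  | .setBit b, Q, σ => Q (σ.mark b)
  | .seq p q, Q, σ => p.wp n W (q.wp n W Q) σ
  | .ite t p q, Q, σ => (t.HoldsIn σ → p.wp n W Q σ) ∧ (¬ t.HoldsIn σ → q.wp n W Q σ)

theorem Code.wp_mono {n W : ℕ} {p : Code} {Q R : State → Prop} {σ : State}
    (h : p.wp n W Q σ) (hQR : ∀ σ, Q σ → R σ) : p.wp n W R σ := by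
  induction p generalizing Q R σ with
  | seq p q ihp ihq => exact ihp h fun σ h => ihq h hQR
  | ite t p q ihp ihq => exact ⟨fun ht => ihp (h.1 ht) hQR, fun ht => ihq (h.2 ht) hQR⟩
  | add | sub | load | store => exact ⟨h.1, hQR _ h.2⟩
  | _ => exact hQR _ h

/-- A configuration with words read as natural numbers. -/
def Config.view {n w : ℕ} (c : Config n w) : State where
  reg k := (c.regs k).toNat
  mem a := if h : a < n then (c.store.cells ⟨a, h⟩).toNat else 0
  bit := c.store.bit

theorem Config.view_setReg {n w : ℕ} (c : Config n w) (d : ℕ) (v : BitVec w) :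
    (c.setReg d v).view = c.view.set d v.toNat := by
  ext k
  · by_cases h : k = d <;> simp [Config.setReg, Config.view, h]
  · rfl
  · rfl

theorem Test.holdsIn_view {n w : ℕ} (c : Config n w) (t : Test) : t.HoldsIn c.view ↔ t.Holds c := by
  cases t <;> simp [Test.HoldsIn, Test.Holds, Config.view, BitVec.toNat_inj]

/-- The side conditions in `Code.wp` exclude wrap-around and bad addresses, so each machine
instruction agrees with its counterpart on natural numbers; without loops the time is at most the
syntactic cost. -/
theorem Code.exec_of_wp {n w : ℕ} (F : Equiv.Perm (Fin n)) {p : Code} {Q : State → Prop}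
    {c : Config n w} (h : p.wp n (2 ^ w) Q c.view) :
    ∃ t c', Exec F p.compile c t c' ∧ t ≤ p.cost ∧ Q c'.view := by
  induction p generalizing Q c with
  | skip => exact ⟨0, c, .skip c, le_rfl, h⟩
  | seq p q ihp ihq =>
    obtain ⟨s, c₁, h₁, hs, h⟩ := ihp h
    obtain ⟨t, c₂, h₂, ht, h⟩ := ihq h
    exact ⟨s + t, c₂, .seq h₁ h₂, Nat.add_le_add hs ht, h⟩
  | ite t p q ihp ihq =>
    by_cases ht : t.Holds c
    · obtain ⟨s, c₁, h₁, hs, h⟩ := ihp (h.1 ((Test.holdsIn_view c t).2 ht))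
      exact ⟨s + 1, c₁, .ite_true ht h₁, Nat.add_le_add_right (hs.trans (le_max_left _ _)) 1, h⟩
    · obtain ⟨s, c₁, h₁, hs, h⟩ := ihq (h.2 fun h => ht ((Test.holdsIn_view c t).1 h))
      exact ⟨s + 1, c₁, .ite_false ht h₁, Nat.add_le_add_right (hs.trans (le_max_right _ _)) 1, h⟩
  | const d k =>
    refine ⟨1, _, .instr _ c, le_rfl, ?_⟩
    simpa [Instr.exec, Config.view_setReg, Code.wp] using h
  | move d a =>
    refine ⟨1, _, .instr _ c, le_rfl, ?_⟩
    rw [Instr.exec, Config.view_setReg]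
    exact h
  | div d a b =>
    refine ⟨1, _, .instr _ c, le_rfl, ?_⟩
    rw [Instr.exec, Config.view_setReg, ArithOp.eval, BitVec.toNat_udiv]
    exact h
  | mod d a b =>
    refine ⟨1, _, .instr _ c, le_rfl, ?_⟩
    rw [Instr.exec, Config.view_setReg, ArithOp.eval, BitVec.toNat_umod]
    exact h
  | add d a b =>
    refine ⟨1, _, .instr _ c, le_rfl, ?_⟩
    have hlt : (c.regs a).toNat + (c.regs b).toNat < 2 ^ w := h.1
    rw [Instr.exec, Config.view_setReg, ArithOp.eval, BitVec.toNat_add, Nat.mod_eq_of_lt hlt]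
    exact h.2
  | sub d a b =>
    refine ⟨1, _, .instr _ c, le_rfl, ?_⟩
    rw [Instr.exec, Config.view_setReg, ArithOp.eval, BitVec.toNat_sub_of_le h.1]
    exact h.2
  | load d a =>
    refine ⟨1, _, .instr _ c, le_rfl, ?_⟩
    have ha : (c.regs a).toNat < n := h.1
    rw [Instr.exec, Config.view_setReg, dif_pos ha]
    have h := h.2
    simp only [Config.view, ha, dite_true] at h
    exact h
  | store a b =>
    refine ⟨1, _, .instr _ c, le_rfl, ?_⟩
    have ha : (c.regs a).toNat < n := h.1
    convert h.2 using 1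
    ext k
    · simp [Instr.exec, Config.view, ha]
    · simp only [Instr.exec, Config.view, ha, dite_true, State.put, Function.update_apply,
        Fin.ext_iff]
      split_ifs <;> simp_all
    · simp [Instr.exec, Config.view, ha]
  | setBit b => exact ⟨1, _, .instr _ c, le_rfl, h⟩

/-! ### Chained blocks

The first `4 * M` cells form `M` blocks; block `x` consists of the cells `x + s * M` for `s < 4`, and
cell `x` doubles as its pointer. There is a border `b`: a block `i ≥ b` and a block `k < b` that
point to each other are linked. A linked block `k` has not been written since the last fill, and
lends its space to block `i`; an unlinked block below the border stores its own contents; an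
unlinked block above the border has not been written since the last fill. -/

/-- The blocks `i` above and `k` below the border point to each other. -/
def Linked (M b : ℕ) (g : ℕ → ℕ) (i k : ℕ) : Prop :=
  b ≤ i ∧ i < M ∧ k < b ∧ g i = k ∧ g k = i

/-- The block `x` below the border stores its own contents. -/
def Home (M b : ℕ) (g : ℕ → ℕ) (x : ℕ) : Prop :=
  x < b ∧ ∀ i, ¬ Linked M b g i x

/-- The contents of block `x` are stored explicitly. -/
def Active (M b : ℕ) (g : ℕ → ℕ) (x : ℕ) : Prop :=
  Home M b g x ∨ ∃ k, Linked M b g x k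

/-- The cell `a` stores the entry `j`. -/
def Loc (M b : ℕ) (g : ℕ → ℕ) (j a : ℕ) : Prop :=
  (4 * M ≤ j ∧ a = j) ∨
  (∃ x s, Home M b g x ∧ s < 4 ∧ j = x + s * M ∧ a = j) ∨
  (∃ x k, Linked M b g x k ∧ j = x ∧ a = x + 3 * M) ∨
  ∃ x k s, Linked M b g x k ∧ 1 ≤ s ∧ s < 4 ∧ j = x + s * M ∧ a = k + s * M

/-- The cells `g` with border `b` and default value `Δ` represent the array `D`. -/
structure Repr (M b Δ : ℕ) (g D : ℕ → ℕ) : Prop where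
  loc : ∀ j a, Loc M b g j a → D j = g a
  default : ∀ x s, x < M → s < 4 → ¬ Active M b g x → D (x + s * M) = Δ

/-- The border and the default value are recorded in the last block, which is then linked, unless
the extra bit is set, which stands for `b = M`. -/
def Header (M : ℕ) (bit : Bool) (g : ℕ → ℕ) (b Δ : ℕ) : Prop :=
  (bit = true ∧ b = M) ∨
  (bit = false ∧ b < M ∧ (∃ k, Linked M b g (M - 1) k) ∧ g (2 * M - 1) = b ∧ g (3 * M - 1) = Δ)

/-- The memory after a store into a cell of block `z`; if thereby `z` gets linked to an unlinked
block above the border, then that block is turned to point to itself. -/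
def storeFix (M b : ℕ) (g : ℕ → ℕ) (z a v : ℕ) : ℕ → ℕ :=
  let g' := Function.update g a v
  if b ≤ g' z ∧ g' z < M ∧ g' (g' z) = z then Function.update g' (g' z) (g' z) else g'

/-! ### The assignment of cells to entries. -/

section

variable {M b Δ : ℕ} {g D : ℕ → ℕ}

theorem slot_inj {x x' s s' : ℕ} (hx : x < M) (hx' : x' < M) (h : x + s * M = x' + s' * M) :
    x = x' ∧ s = s' := by
  have h₁ := congrArg (· % M) h
  have h₂ := congrArg (· / M) h
  have hM : 0 < M := by omega
  simpa [Nat.add_mul_mod_self_right, Nat.mod_eq_of_lt hx, Nat.mod_eq_of_lt hx',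
    Nat.add_mul_div_right _ _ hM, Nat.div_eq_of_lt hx, Nat.div_eq_of_lt hx'] using And.intro h₁ h₂

theorem slot_lt {x s : ℕ} (hx : x < M) (hs : s < 4) : x + s * M < 4 * M := by
  have : (s + 1) * M ≤ 4 * M := Nat.mul_le_mul_right M hs
  rw [Nat.succ_mul] at this
  omega

theorem Linked.left_inj {i i' k : ℕ} (h : Linked M b g i k) (h' : Linked M b g i' k) : i = i' := by
  unfold Linked at *; omega

theorem Linked.right_inj {i k k' : ℕ} (h : Linked M b g i k) (h' : Linked M b g i k') :
    k = k' := by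
  unfold Linked at *; omega

/-- The block and the slot of an entry, and the block and the slot of the cell that stores it. -/
theorem Loc.cases {j a : ℕ} (hb : b ≤ M) (h : Loc M b g j a) :
    (4 * M ≤ j ∧ a = j) ∨ ∃ x s y t, x < M ∧ s < 4 ∧ y < M ∧ t < 4 ∧ j = x + s * M ∧
      a = y + t * M ∧ ((Home M b g x ∧ y = x ∧ t = s) ∨ (Linked M b g x y ∧ 1 ≤ s ∧ t = s) ∨
        (∃ k, Linked M b g x k) ∧ s = 0 ∧ y = x ∧ t = 3) := by
  rcases h with h | ⟨x, s, h, hs, rfl, rfl⟩ | ⟨x, k, h, rfl, rfl⟩ | ⟨x, k, s, h, h1, hs, rfl, rfl⟩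
  · exact .inl h
  · have := h.1
    exact .inr ⟨x, s, x, s, by omega, hs, by omega, hs, rfl, rfl, .inl ⟨h, rfl, rfl⟩⟩
  · exact .inr ⟨j, 0, j, 3, h.2.1, by omega, h.2.1, by omega, by omega, rfl,
      .inr (.inr ⟨⟨k, h⟩, rfl, rfl, rfl⟩)⟩
  · have := h.2.2.1
    exact .inr ⟨x, s, k, s, h.2.1, hs, by omega, hs, rfl, rfl, .inr (.inl ⟨h, h1, rfl⟩)⟩

/-- No two entries share a cell: a block at home lends nothing, a lender serves only one upper
block, and an upper block keeps just its entry `0`, in its own slot `3`. Hence a store changes one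
entry only. -/
theorem Loc.inj {j j' a : ℕ} (hb : b ≤ M) (h : Loc M b g j a) (h' : Loc M b g j' a) : j = j' := by
  obtain ⟨h, rfl⟩ | ⟨x, s, y, t, hx, hs, hy, ht, rfl, rfl, c⟩ := h.cases hb
  · obtain ⟨h', rfl⟩ | ⟨x', s', y', t', hx', hs', hy', ht', rfl, e, c'⟩ := h'.cases hb
    · rfl
    · have := slot_lt hy' ht'; omega
  · obtain ⟨h', rfl⟩ | ⟨x', s', y', t', hx', hs', hy', ht', rfl, e, c'⟩ := h'.cases hb
    · have := slot_lt hy ht; omega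
    · obtain ⟨rfl, rfl⟩ := slot_inj hy hy' e
      suffices x = x' ∧ s = s' by rw [this.1, this.2]
      rcases c with ⟨c, rfl, rfl⟩ | ⟨c, c1, rfl⟩ | ⟨⟨k, c⟩, rfl, rfl, rfl⟩ <;>
        rcases c' with ⟨c', rfl, rfl⟩ | ⟨c', c1', rfl⟩ | ⟨⟨k', c'⟩, rfl, e', e''⟩
      · exact ⟨rfl, rfl⟩
      · exact (c.2 _ c').elim
      · have := c.1; have := c'.1; omega
      · exact (c'.2 _ c).elim
      · exact ⟨c.left_inj c', rfl⟩
      · have := c.2.2.1; have := c'.1; omega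
      · have := c'.1; have := c.1; omega
      · have := c'.2.2.1; have := c.1; omega
      · exact ⟨e', rfl⟩

theorem Loc.unique {j a a' : ℕ} (hb : b ≤ M) (h : Loc M b g j a) (h' : Loc M b g j a') :
    a = a' := by
  obtain ⟨h, rfl⟩ | ⟨x, s, y, t, hx, hs, hy, ht, rfl, rfl, c⟩ := h.cases hb
  · obtain ⟨h', rfl⟩ | ⟨x', s', y', t', hx', hs', hy', ht', rfl, e, c'⟩ := h'.cases hb
    · rfl
    · have := slot_lt hx' hs'; omega
  · obtain ⟨h', rfl⟩ | ⟨x', s', y', t', hx', hs', hy', ht', e, rfl, c'⟩ := h'.cases hb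
    · have := slot_lt hx hs; omega
    · obtain ⟨rfl, rfl⟩ := slot_inj hx hx' e
      suffices y = y' ∧ t = t' by rw [this.1, this.2]
      rcases c with ⟨c, rfl, rfl⟩ | ⟨c, c1, rfl⟩ | ⟨⟨k, c⟩, rfl, rfl, rfl⟩ <;>
        rcases c' with ⟨c', rfl, rfl⟩ | ⟨c', c1', rfl⟩ | ⟨⟨k', c'⟩, e'', e', h3⟩
      · exact ⟨rfl, rfl⟩
      · have := c.1; have := c'.1; omega
      · have := c.1; have := c'.1; omega
      · have := c'.1; have := c.1; omega
      · exact ⟨c.right_inj c', rfl⟩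
      · omega
      · have := c'.1; have := c.1; omega
      · omega
      · exact ⟨e'.symm, h3.symm⟩

theorem Loc.active {x s a : ℕ} (hb : b ≤ M) (hx : x < M) (hs : s < 4)
    (h : Loc M b g (x + s * M) a) : Active M b g x := by
  obtain ⟨h, rfl⟩ | ⟨x', s', y, t, hx', hs', hy, ht, e, rfl, c⟩ := h.cases hb
  · have := slot_lt hx hs; omega
  · obtain ⟨rfl, rfl⟩ := slot_inj hx hx' e
    rcases c with ⟨c, -⟩ | ⟨c, -⟩ | ⟨⟨k, c⟩, -⟩
    · exact .inl c
    · exact .inr ⟨_, c⟩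
    · exact .inr ⟨_, c⟩

/-- A pointer cell stores an entry only if its block stores its own contents. -/
theorem Loc.cell {j a : ℕ} (hb : b ≤ M) (h : Loc M b g j a) (ha : a < M) : Home M b g a ∧ j = a := by
  obtain ⟨h, rfl⟩ | ⟨x, s, y, t, hx, hs, hy, ht, rfl, rfl, c⟩ := h.cases hb
  · omega
  · have : t = 0 := by
      by_contra h0
      have := Nat.mul_le_mul_right M (Nat.one_le_iff_ne_zero.2 h0)
      omega
    subst this
    rcases c with ⟨c, rfl, rfl⟩ | ⟨c, c1, rfl⟩ | ⟨⟨k, c⟩, rfl, rfl, e⟩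
    · simpa using c
    · omega
    · omega

/-- The cells that record the border and the default value do not store entries. -/
theorem Loc.ne_header {j a : ℕ} (hb : b < M) (h : Loc M b g j a) :
    a ≠ 2 * M - 1 ∧ a ≠ 3 * M - 1 := by
  obtain ⟨h, rfl⟩ | ⟨x, s, y, t, hx, hs, hy, ht, rfl, rfl, c⟩ := h.cases hb.le
  · omega
  · have key : y = M - 1 → t = 3 := by
      rcases c with ⟨c, rfl, rfl⟩ | ⟨c, c1, rfl⟩ | ⟨⟨k, c⟩, rfl, rfl, rfl⟩
      · have := c.1; omega
      · have := c.2.2.1; omega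
      · exact fun _ => rfl
    constructor <;> intro e
    · have e' : y + t * M = (M - 1) + 1 * M := by omega
      obtain ⟨h₁, h₂⟩ := slot_inj hy (by omega) e'
      have := key h₁; omega
    · have e' : y + t * M = (M - 1) + 2 * M := by omega
      obtain ⟨h₁, h₂⟩ := slot_inj hy (by omega) e'
      have := key h₁; omega

/-- The layout depends on the memory only through the links, so for a change that preserves them it
remains to compare values cell by cell. -/
theorem Loc.congr {g' : ℕ → ℕ} (hL : Linked M b g' = Linked M b g) : Loc M b g' = Loc M b g := by
  unfold Loc Home; rw [hL]

theorem Active.congr {g' : ℕ → ℕ} (hL : Linked M b g' = Linked M b g) :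
    Active M b g' = Active M b g := by
  unfold Active Home; rw [hL]

theorem Repr.congr {g' D' : ℕ → ℕ} (hL : Linked M b g' = Linked M b g)
    (hD : ∀ j a, Loc M b g j a → D' j = g' a)
    (hΔ : ∀ x s, x < M → s < 4 → ¬ Active M b g x → D' (x + s * M) = Δ) : Repr M b Δ g' D' :=
  ⟨by rwa [Loc.congr hL], by rwa [Active.congr hL]⟩

theorem Header.congr {bit : Bool} {g' : ℕ → ℕ} (h : Header M bit g b Δ)
    (hL : Linked M b g' = Linked M b g)
    (hg : b < M → g' (2 * M - 1) = g (2 * M - 1) ∧ g' (3 * M - 1) = g (3 * M - 1)) :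
    Header M bit g' b Δ := by
  obtain h | ⟨h₀, h₁, h₂, h₃, h₄⟩ := h
  · exact .inl h
  · exact .inr ⟨h₀, h₁, by rwa [hL], by rw [(hg h₁).1, h₃], by rw [(hg h₁).2, h₄]⟩

theorem Header.le {bit : Bool} (h : Header M bit g b Δ) : b ≤ M := by
  obtain h | h := h
  · exact h.2.le
  · exact h.2.1.le

/-! ### Stores that do not create links. -/

/-- A store outside the pointer cells never triggers the repair, because block `z` is active and so
is not a lender. A store into a pointer cell hits slot `0` of a block at home, and there the repair
fires exactly when block `v` already points to `z`. -/
theorem storeFix_cases {z s a v : ℕ} (hb : b ≤ M) (hz : z < M) (hs : s < 4)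
    (h : Loc M b g (z + s * M) a) :
    (M ≤ a ∧ storeFix M b g z a v = Function.update g a v) ∨
    (a = z ∧ s = 0 ∧ Home M b g z ∧ ¬ (b ≤ v ∧ v < M ∧ g v = z) ∧
      storeFix M b g z a v = Function.update g z v) ∨
    (a = z ∧ s = 0 ∧ Home M b g z ∧ (b ≤ v ∧ v < M ∧ g v = z) ∧
      storeFix M b g z a v = Function.update (Function.update g z v) v v) := by
  by_cases ha : a < M
  · right
    obtain ⟨h₁, h₂⟩ := h.cell hb ha
    have h₂' : z + s * M = a + 0 * M := by omega
    obtain ⟨rfl, rfl⟩ := slot_inj hz ha h₂'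
    have hv : b ≤ v → v ≠ z := by have := h₁.1; omega
    by_cases hc : b ≤ v ∧ v < M ∧ g v = z
    · right
      have := hv hc.1
      exact ⟨rfl, rfl, h₁, hc, by simp [storeFix, hc, Function.update_of_ne this]⟩
    · left
      refine ⟨rfl, rfl, h₁, hc, ?_⟩
      simp only [storeFix, Function.update_self]
      rw [if_neg]
      rintro ⟨c₁, c₂, c₃⟩
      rw [Function.update_of_ne (hv c₁)] at c₃
      exact hc ⟨c₁, c₂, c₃⟩
  · left
    refine ⟨not_lt.1 ha, ?_⟩
    have e : ∀ c, c < M → Function.update g a v c = g c := fun c hc =>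
      Function.update_of_ne (by omega) _ _
    simp only [storeFix, e z hz]
    rw [if_neg]
    rintro ⟨c₁, c₂, c₃⟩
    rw [e _ c₂] at c₃
    obtain hA | ⟨k, hA⟩ := h.active hb hz hs
    · exact hA.2 (g z) ⟨c₁, c₂, hA.1, c₃, rfl⟩
    · have := hA.2.2.1; have := hA.2.2.2.1; omega

/-- The only link that could arise joins `z` to block `v`. Turning `v` to itself prevents it and
breaks no old link: `v` pointed to `z`, which was not linked. -/
theorem linked_storeFix {z s a v : ℕ} (hb : b ≤ M) (hz : z < M) (hs : s < 4)
    (h : Loc M b g (z + s * M) a) : Linked M b (storeFix M b g z a v) = Linked M b g := by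
  ext i k
  obtain ⟨ha, e⟩ | ⟨rfl, rfl, hH, hc, e⟩ | ⟨rfl, rfl, hH, hc, e⟩ :=
    storeFix_cases (v := v) hb hz hs h <;> rw [e]
  · unfold Linked
    refine and_congr_right fun h₁ => and_congr_right fun h₂ => and_congr_right fun h₃ => ?_
    rw [Function.update_of_ne (by omega), Function.update_of_ne (by omega)]
  · have h₀ := hH.1
    have h₁ := hH.2 i
    unfold Linked at *
    grind
  · have h₀ := hH.1
    have h₁ := hH.2 i
    unfold Linked at *
    grind

/-- Besides the target, the repair touches only a pointer cell in `[b, M)`, and by `Loc.lt_or_le`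
such cells store no entry. -/
theorem storeFix_apply {z s a v c : ℕ} (hb : b ≤ M) (hz : z < M) (hs : s < 4)
    (h : Loc M b g (z + s * M) a) (hc : M ≤ c ∨ c < b) :
    storeFix M b g z a v c = if c = a then v else g c := by
  obtain ⟨ha, e⟩ | ⟨rfl, rfl, hH, hv, e⟩ | ⟨rfl, rfl, hH, hv, e⟩ :=
    storeFix_cases (v := v) hb hz hs h <;> rw [e]
  · simp [Function.update_apply]
  · simp [Function.update_apply]
  · rw [Function.update_of_ne (by omega), Function.update_apply]

theorem Loc.lt_or_le {j a : ℕ} (hb : b ≤ M) (h : Loc M b g j a) : M ≤ a ∨ a < b := by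
  by_cases ha : a < M
  · exact .inr (h.cell hb ha).1.1
  · exact .inl (not_lt.1 ha)

theorem Repr.storeFix {z s a v : ℕ} (hb : b ≤ M) (hz : z < M) (hs : s < 4)
    (h : Loc M b g (z + s * M) a) (hD : Repr M b Δ g D) :
    Repr M b Δ (storeFix M b g z a v) (Function.update D (z + s * M) v) := by
  refine .congr (linked_storeFix hb hz hs h) (fun j a' h' => ?_) fun x t hx ht hA => ?_
  · rw [storeFix_apply hb hz hs h (h'.lt_or_le hb)]
    by_cases e : j = z + s * M
    · subst e
      simp [h'.unique hb h]
    · rw [Function.update_of_ne e, if_neg, hD.loc j a' h']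
      rintro rfl
      exact e (h'.inj hb h)
  · rw [Function.update_of_ne, hD.default x t hx ht hA]
    intro e
    rw [← e] at h
    exact hA (h.active hb hx ht)

theorem Header.storeFix {bit : Bool} {z s a v : ℕ} (hz : z < M) (hs : s < 4)
    (h : Loc M b g (z + s * M) a) (hH : Header M bit g b Δ) :
    Header M bit (storeFix M b g z a v) b Δ := by
  have hb := hH.le
  refine hH.congr (linked_storeFix hb hz hs h) fun hb' => ?_
  have := h.ne_header hb'
  rw [storeFix_apply hb hz hs h (.inl (by omega)), storeFix_apply hb hz hs h (.inl (by omega)),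
    if_neg this.1.symm, if_neg this.2.symm]
  exact ⟨rfl, rfl⟩

/-! #### Moving the border -/

theorem linked_update_self {y : ℕ} (hy : b ≤ y) (h : ∀ k, ¬ Linked M b g y k) :
    Linked M b (Function.update g y y) = Linked M b g := by
  ext i k
  have h := h k
  unfold Linked at *
  grind

theorem Repr.update_self {y : ℕ} (hb : b ≤ M) (hy : b ≤ y) (hyM : y < M)
    (h : ∀ k, ¬ Linked M b g y k) (hD : Repr M b Δ g D) :
    Repr M b Δ (Function.update g y y) D := by
  refine .congr (linked_update_self hy h) (fun j a' h' => ?_) hD.default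
  rw [hD.loc j a' h', Function.update_of_ne]
  have := h'.lt_or_le hb
  omega

theorem Header.update_self {bit : Bool} {y : ℕ} (hy : b ≤ y) (hyM : y < M)
    (h : ∀ k, ¬ Linked M b g y k) (hH : Header M bit g b Δ) :
    Header M bit (Function.update g y y) b Δ := by
  refine hH.congr (linked_update_self hy h) fun hb' => ?_
  rw [Function.update_of_ne (by omega), Function.update_of_ne (by omega)]
  exact ⟨rfl, rfl⟩

/-- The memory after the border has been moved up by one. -/
def bump (M b : ℕ) (g : ℕ → ℕ) : ℕ → ℕ :=
  if b + 1 < M then Function.update g (2 * M - 1) (b + 1) else g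

theorem bump_apply {c : ℕ} (hc : c ≠ 2 * M - 1) : bump M b g c = g c := by
  unfold bump; split_ifs
  · rw [Function.update_of_ne hc]
  · rfl

/-- Block `b` passes below the border. The bound on its pointer keeps it from being linked to a
block above the new border, so the only change is the loss of its own former link. -/
theorem linked_bump (hb : b < M) (hg : g b ≤ b) {i k : ℕ} :
    Linked M (b + 1) (bump M b g) i k ↔ Linked M b g i k ∧ i ≠ b := by
  unfold Linked
  by_cases h : b + 1 ≤ i ∧ i < M ∧ k < b + 1
  · rw [bump_apply (by omega), bump_apply (by omega)]
    by_cases hk : k = b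
    · subst hk; omega
    · omega
  · omega

/-- The last block keeps its link until it is itself the block at the border; at that moment the bit
takes over from the header. -/
theorem Header.bump {bit : Bool} (hb : b < M) (hg : g b ≤ b) (hH : Header M bit g b Δ) :
    Header M (if b + 1 < M then bit else true) (bump M b g) (b + 1) Δ := by
  obtain ⟨-, h⟩ | ⟨h₀, h₁, ⟨k, h₂⟩, h₃, h₄⟩ := hH
  · omega
  · split_ifs with h
    · refine .inr ⟨h₀, h, ⟨k, (linked_bump hb hg).2 ⟨h₂, by omega⟩⟩, ?_, ?_⟩
      · simp [FillableArray.bump, h]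
      · rw [bump_apply (by omega), h₄]
    · exact .inl ⟨rfl, by omega⟩

/-! #### Linking two blocks -/

/-- The memory after the blocks `p` and `f` have been made to point to each other. -/
def link (g : ℕ → ℕ) (p f : ℕ) : ℕ → ℕ :=
  Function.update (Function.update g f p) p f

/-- As `f` was at home, redirecting its pointer breaks no link; redirecting `p` breaks at most the
old link of `p`. -/
theorem linked_link {p f : ℕ} (hp : b ≤ p) (hpM : p < M) (hf : Home M b g f) {i k : ℕ} :
    Linked M b (link g p f) i k ↔ (i = p ∧ k = f) ∨ (i ≠ p ∧ Linked M b g i k) := by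
  have h₀ := hf.1
  have h₁ := hf.2 i
  unfold Linked link at *
  grind

theorem link_apply {p f c : ℕ} (hp : c ≠ p) (hf : c ≠ f) : link g p f c = g c := by
  rw [link, Function.update_of_ne hp, Function.update_of_ne hf]

theorem Header.link {bit : Bool} {p f : ℕ} (hp : b ≤ p) (hpM : p < M) (hf : Home M b g f)
    (hH : Header M bit g b Δ) : Header M bit (link g p f) b Δ := by
  have := hf.1
  obtain h | ⟨h₀, h₁, ⟨k, h₂⟩, h₃, h₄⟩ := hH
  · exact .inl h
  · refine .inr ⟨h₀, h₁, ?_, ?_, ?_⟩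
    · by_cases e : M - 1 = p
      · exact ⟨f, (linked_link hp hpM hf).2 (.inl ⟨e, rfl⟩)⟩
      · exact ⟨k, (linked_link hp hpM hf).2 (.inr ⟨e, h₂⟩)⟩
    · rw [link_apply (by omega) (by omega), h₃]
    · rw [link_apply (by omega) (by omega), h₄]

end

/-! ### How the represented array changes when the border moves or blocks are linked. -/

section

variable {M b Δ : ℕ} {g D : ℕ → ℕ}

theorem exists_slot {j : ℕ} (hj : j < 4 * M) : ∃ x s, x < M ∧ s < 4 ∧ j = x + s * M := by
  have hM : 0 < M := by omega
  exact ⟨j % M, j / M, Nat.mod_lt _ hM, Nat.div_lt_of_lt_mul (by rwa [mul_comm]), by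
    rw [mul_comm]; exact (Nat.mod_add_div j M).symm⟩

theorem Home.loc {x s : ℕ} (h : Home M b g x) (hs : s < 4) :
    Loc M b g (x + s * M) (x + s * M) :=
  .inr (.inl ⟨x, s, h, hs, rfl, rfl⟩)

theorem Linked.loc_zero {x k : ℕ} (h : Linked M b g x k) : Loc M b g x (x + 3 * M) :=
  .inr (.inr (.inl ⟨x, k, h, rfl, rfl⟩))

theorem Linked.loc {x k s : ℕ} (h : Linked M b g x k) (h1 : 1 ≤ s) (hs : s < 4) :
    Loc M b g (x + s * M) (k + s * M) :=
  .inr (.inr (.inr ⟨x, k, s, h, h1, hs, rfl, rfl⟩))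

theorem Linked.not_active {x k : ℕ} (h : Linked M b g x k) : ¬ Active M b g k := by
  rintro (h' | ⟨i, h'⟩)
  · exact h'.2 _ h
  · have := h.2.2.1; have := h'.1; omega

theorem Home.congr {g' : ℕ → ℕ} (hL : Linked M b g' = Linked M b g) : Home M b g' = Home M b g := by
  unfold Home; rw [hL]

/-- Block `b` and its former lender, if any, come to be at home, so their new contents are whatever
their cells happen to hold. Passing to such an intermediate `D'` separates the move of the border
from the later repair of these two blocks. -/
theorem Repr.bump {D' : ℕ → ℕ} (hb : b < M) (hg : g b ≤ b) (hD : Repr M b Δ g D)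
    (h₁ : ∀ s < 4, D' (b + s * M) = g (b + s * M))
    (h₂ : ∀ z, Linked M b g b z → ∀ s < 4, D' (z + s * M) = g (z + s * M))
    (h₃ : ∀ j, (∀ s < 4, j ≠ b + s * M) →
      (∀ z, Linked M b g b z → ∀ s < 4, j ≠ z + s * M) → D' j = D j) :
    Repr M (b + 1) Δ (bump M b g) D' := by
  constructor
  · intro j a h
    have hga : FillableArray.bump M b g a = g a := by
      by_cases hb' : b + 1 < M
      · exact bump_apply (h.ne_header hb').1
      · simp [FillableArray.bump, hb']
    have hne : ∀ {x s}, x < M → s < 4 → x ≠ b → (∀ z, Linked M b g b z → x ≠ z) →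
        D' (x + s * M) = D (x + s * M) := by
      intro x s hx hs hxb hxz
      refine h₃ _ (fun t _ e => hxb (slot_inj hx hb e).1) fun z hz t _ e => ?_
      have := hz.2.2.1
      exact hxz z hz (slot_inj hx (by omega) e).1
    rw [hga]
    rcases h with ⟨h, rfl⟩ | ⟨x, s, h, hs, rfl, rfl⟩ | ⟨x, k, h, rfl, rfl⟩ |
      ⟨x, k, s, h, h1, hs, rfl, rfl⟩
    · rw [h₃, hD.loc a a (.inl ⟨h, rfl⟩)]
      · intro s hs; have := slot_lt hb hs; omega
      · intro z hz s hs
        have hz' : z < M := by have := hz.2.2.1; omega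
        have := slot_lt hz' hs; omega
    · by_cases hxb : x = b
      · subst hxb; exact h₁ s hs
      have hx : x < b := by have := h.1; omega
      by_cases hxz : Linked M b g b x
      · exact h₂ x hxz s hs
      · rw [hne (by omega) hs hxb fun z hz e => hxz (e ▸ hz)]
        refine hD.loc _ _ (.inr (.inl ⟨x, s, ⟨hx, fun i hi => ?_⟩, hs, rfl, rfl⟩))
        by_cases hib : i = b
        · exact hxz (hib ▸ hi)
        · exact h.2 i ((linked_bump hb hg).2 ⟨hi, hib⟩)
    · obtain ⟨h, hjb⟩ := (linked_bump hb hg).1 h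
      have e := @hne j 0 h.2.1 (by omega) hjb fun z hz e => by
        have := hz.2.2.1; have := h.1; omega
      simp only [zero_mul, add_zero] at e
      rw [e, hD.loc _ _ h.loc_zero]
    · obtain ⟨h, hxb⟩ := (linked_bump hb hg).1 h
      rw [hne h.2.1 hs hxb fun z hz e => by have := hz.2.2.1; have := h.1; omega,
        hD.loc _ _ (h.loc h1 hs)]
  · intro x s hx hs hA
    have hxb : x ≠ b := by
      rintro rfl
      exact hA (.inl ⟨by omega, fun i hi => by have := hi.1; have := (linked_bump hb hg).1 hi
                                               have := this.1.2.2.1; omega⟩)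
    have hxz : ¬ Linked M b g b x := fun h => hA (.inl ⟨by have := h.2.2.1; omega, fun i hi => by
      obtain ⟨hi, hib⟩ := (linked_bump hb hg).1 hi
      exact hib (hi.left_inj h)⟩)
    rw [h₃, hD.default x s hx hs]
    · rintro (h | ⟨k, h⟩)
      · refine hA (.inl ⟨by have := h.1; omega, fun i hi => ?_⟩)
        exact h.2 i ((linked_bump hb hg).1 hi).1
      · exact hA (.inr ⟨k, (linked_bump hb hg).2 ⟨h, hxb⟩⟩)
    · exact fun t _ e => hxb (slot_inj hx hb e).1
    · intro z hz t _ e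
      have := hz.2.2.1
      exact hxz ((slot_inj hx (by omega) e).1 ▸ hz)

/-- Three blocks change their role: `f` becomes a lender and hence inactive, `p` is read from its
slot `3` and from `f`, and a former lender of `p` is again at home with the raw contents of its
cells. -/
theorem Repr.link {D' : ℕ → ℕ} {p f : ℕ} (hb : b ≤ M) (hp : b ≤ p) (hpM : p < M)
    (hf : Home M b g f) (hD : Repr M b Δ g D)
    (h₁ : ∀ s < 4, D' (f + s * M) = Δ)
    (h₂ : D' p = g (p + 3 * M)) (h₃ : ∀ s, 1 ≤ s → s < 4 → D' (p + s * M) = g (f + s * M))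
    (h₄ : ∀ x, Linked M b g p x → ∀ s < 4, D' (x + s * M) = g (x + s * M))
    (h₅ : ∀ x s, x < M → s < 4 → x ≠ f → x ≠ p → ¬ Linked M b g p x →
      D' (x + s * M) = D (x + s * M))
    (h₆ : ∀ j, 4 * M ≤ j → D' j = D j) :
    Repr M b Δ (link g p f) D' := by
  have hfb := hf.1
  have hfM : f < M := by omega
  have hne : ∀ {j a}, Loc M b (FillableArray.link g p f) j a → a ≠ p ∧ a ≠ f := by
    intro j a h
    constructor
    · rintro rfl
      have := h.lt_or_le hb; omega
    · rintro rfl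
      exact (h.cell hb hfM).1.2 p ((linked_link hp hpM hf).2 (.inl ⟨rfl, rfl⟩))
  constructor
  · intro j a h
    rw [link_apply (hne h).1 (hne h).2]
    rcases h with ⟨h, rfl⟩ | ⟨x, s, h, hs, rfl, rfl⟩ | ⟨x, k, h, rfl, rfl⟩ |
      ⟨x, k, s, h, h1, hs, rfl, rfl⟩
    · rw [h₆ _ h, hD.loc a a (.inl ⟨h, rfl⟩)]
    · have hxf : x ≠ f := by
        rintro rfl
        exact h.2 p ((linked_link hp hpM hf).2 (.inl ⟨rfl, rfl⟩))
      have hxb := h.1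
      by_cases hx : Linked M b g p x
      · exact h₄ x hx s hs
      · rw [h₅ x s (by omega) hs hxf (by omega) hx]
        refine hD.loc _ _ (Home.loc ⟨hxb, fun i hi => ?_⟩ hs)
        by_cases hip : i = p
        · exact hx (hip ▸ hi)
        · exact h.2 i ((linked_link hp hpM hf).2 (.inr ⟨hip, hi⟩))
    · obtain ⟨rfl, rfl⟩ | ⟨hjp, h⟩ := (linked_link hp hpM hf).1 h
      · exact h₂
      · have := h.1
        have e := h₅ j 0 h.2.1 (by omega) (by omega) hjp fun h' => by
          have := h'.2.2.1; omega
        simp only [zero_mul, add_zero] at e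
        rw [e, hD.loc _ _ h.loc_zero]
    · obtain ⟨rfl, rfl⟩ | ⟨hjp, h⟩ := (linked_link hp hpM hf).1 h
      · exact h₃ s h1 hs
      · have := h.1
        rw [h₅ x s h.2.1 hs (by omega) hjp fun h' => by have := h'.2.2.1; omega,
          hD.loc _ _ (h.loc h1 hs)]
  · intro x s hx hs hA
    by_cases hxf : x = f
    · subst hxf; exact h₁ s hs
    have hxp : x ≠ p := by
      rintro rfl
      exact hA (.inr ⟨f, (linked_link hp hpM hf).2 (.inl ⟨rfl, rfl⟩)⟩)
    have hpx : ¬ Linked M b g p x := by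
      intro h
      refine hA (.inl ⟨h.2.2.1, fun i hi => ?_⟩)
      obtain ⟨rfl, rfl⟩ | ⟨hip, hi⟩ := (linked_link hp hpM hf).1 hi
      · exact hxf rfl
      · exact hip (hi.left_inj h)
    rw [h₅ x s hx hs hxf hxp hpx, hD.default x s hx hs]
    rintro (h | ⟨k, h⟩)
    · refine hA (.inl ⟨h.1, fun i hi => ?_⟩)
      obtain ⟨rfl, rfl⟩ | ⟨hip, hi⟩ := (linked_link hp hpM hf).1 hi
      · exact hxf rfl
      · exact h.2 i hi
    · exact hA (.inr ⟨k, (linked_link hp hpM hf).2 (.inr ⟨hxp, h⟩)⟩)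

end

/-! ### Code for the operations

Register `3` holds the number `M` of blocks, register `4` the border, register `5` the default
value and register `6` the block of the index in register `1`. -/

/-- Store `R[v]` into cell `R[a]` of block `R[z]` by `storeFix`. -/
def setCell (z a v : ℕ) : Code :=
  .store a v ;; .load 20 z ;;
  .ite (.lt 20 4) .skip (.ite (.lt 20 3)
    (.load 21 20 ;; .ite (.eq 21 z) (.store 20 20) .skip) .skip)

/-- Give the default value to all entries of block `R[f]`, which stores its own contents. -/
def clearBlock (f : ℕ) : Code :=
  setCell f f 5 ;; .add 15 f 3 ;; setCell f 15 5 ;; .add 15 15 3 ;; setCell f 15 5 ;;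
  .add 15 15 3 ;; setCell f 15 5

/-- Copy all cells but the first from block `R[z]` to block `R[y]`. -/
def copyCells (y z : ℕ) : Code :=
  .add 15 y 3 ;; .add 16 z 3 ;; .load 17 16 ;; setCell y 15 17 ;;
  .add 15 15 3 ;; .add 16 16 3 ;; .load 17 16 ;; setCell y 15 17 ;;
  .add 15 15 3 ;; .add 16 16 3 ;; .load 17 16 ;; setCell y 15 17

/-- The state represents the array `D`. -/
structure Inv (M b Δ : ℕ) (D : ℕ → ℕ) (σ : State) : Prop where
  reg_three : σ.reg 3 = M
  reg_four : σ.reg 4 = b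
  reg_five : σ.reg 5 = Δ
  header : Header M σ.bit σ.mem b Δ
  repr : Repr M b Δ σ.mem D

/-! ### Correctness of the basic subroutines. -/

section

variable {n W M b Δ : ℕ} {D : ℕ → ℕ} {σ : State}

/-- The tests carry out the repair of `storeFix`. Registers `20` and `21` are scratch, so all
registers below `20` survive; callers of this code may rely on them. -/
theorem wp_setCell (hM : 4 * M < n) (hI : Inv M b Δ D σ) {z a v x s j : ℕ}
    (hz : z < 20) (hzx : σ.reg z = x) (hx : x < M) (hs : s < 4) (hj : j = x + s * M)
    (h : Loc M b σ.mem j (σ.reg a)) :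
    (setCell z a v).wp n W (fun τ => Inv M b Δ (Function.update D j (σ.reg v)) τ ∧
      Linked M b τ.mem = Linked M b σ.mem ∧ (∀ k < 20, τ.reg k = σ.reg k) ∧
      ∀ c, M ≤ c → τ.mem c = if c = σ.reg a then σ.reg v else σ.mem c) σ := by
  subst hj
  have hb := hI.header.le
  have ha : σ.reg a < n := by
    obtain h | ⟨x', s', y, t, hx', hs', hy, ht, -, e, -⟩ := h.cases hb
    · have := slot_lt hx hs; omega
    · rw [e]; have := slot_lt hy ht; omega
  suffices key : ∀ Q : State → Prop, (∀ τ : State, (∀ k < 20, τ.reg k = σ.reg k) →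
      τ.bit = σ.bit → τ.mem = storeFix M b σ.mem x (σ.reg a) (σ.reg v) → Q τ) →
      (setCell z a v).wp n W Q σ by
    refine key _ fun τ hr hbit hm => ⟨⟨?_, ?_, ?_, ?_, ?_⟩, ?_, hr, ?_⟩
    · rw [hr _ (by norm_num), hI.reg_three]
    · rw [hr _ (by norm_num), hI.reg_four]
    · rw [hr _ (by norm_num), hI.reg_five]
    · rw [hm, hbit]; exact hI.header.storeFix hx hs h
    · rw [hm]; exact hI.repr.storeFix hb hx hs h
    · rw [hm]; exact linked_storeFix hb hx hs h
    · rw [hm]; exact fun c hc => storeFix_apply hb hx hs h (.inl hc)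
  intro Q hQ
  have hz' : z ≠ 20 := by omega
  have hz'' : z ≠ 21 := by omega
  simp only [setCell, Code.wp, Test.HoldsIn, State.set_reg, State.put_reg, State.set_mem,
    State.put_mem, reduceIte, Nat.reduceEqDiff, hz', hz'', hI.reg_three, hI.reg_four, hzx]
  set g' := Function.update σ.mem (σ.reg a) (σ.reg v) with hg'
  have hreg : ∀ u v' : ℕ, ∀ k < 20,
      (if k = 21 then v' else if k = 20 then u else σ.reg k) = σ.reg k := by
    intro u v' k hk; rw [if_neg (by omega), if_neg (by omega)]
  have hreg' : ∀ u : ℕ, ∀ k < 20, (if k = 20 then u else σ.reg k) = σ.reg k := by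
    intro u k hk; rw [if_neg (by omega)]
  refine ⟨ha, by omega, fun h₁ => hQ _ ?_ rfl ?_, fun h₁ => ⟨fun h₂ => ⟨by omega,
    fun h₃ => ⟨by omega, hQ _ ?_ rfl ?_⟩, fun h₃ => hQ _ ?_ rfl ?_⟩, fun h₂ => hQ _ ?_ rfl ?_⟩⟩
  all_goals simp only [State.set_reg, State.put_reg, State.set_mem, State.put_mem]
  any_goals first | exact hreg _ _ | exact hreg' _
  all_goals
    simp only [storeFix, ← hg']
    first
    | rw [if_pos ⟨by omega, by omega, by omega⟩]
    | rw [if_neg (by omega)]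

end

section

variable {n W M b Δ : ℕ} {D : ℕ → ℕ} {σ : State}

theorem Inv.set (hI : Inv M b Δ D σ) {d v : ℕ} (hd : 5 < d) : Inv M b Δ D (σ.set d v) := by
  refine ⟨?_, ?_, ?_, hI.header, hI.repr⟩ <;> rw [State.set_reg, if_neg (by omega)]
  · exact hI.reg_three
  · exact hI.reg_four
  · exact hI.reg_five

theorem Inv.congr {D' : ℕ → ℕ} (hI : Inv M b Δ D σ) (h : ∀ j, D' j = D j) : Inv M b Δ D' σ := by
  rwa [funext h]

theorem Home.of_eq {g g' : ℕ → ℕ} {x : ℕ} (h : Home M b g x)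
    (hL : Linked M b g' = Linked M b g) : Home M b g' x := by
  rwa [Home.congr hL]

theorem wp_clearBlock (hM : 4 * M < n) (hW : n ≤ W) (hI : Inv M b Δ D σ) {f x : ℕ} (hf : f < 15)
    (hfx : σ.reg f = x) (hx : Home M b σ.mem x) {D' : ℕ → ℕ}
    (h₁ : ∀ s < 4, D' (x + s * M) = Δ) (h₂ : ∀ j, (∀ s < 4, j ≠ x + s * M) → D' j = D j) :
    (clearBlock f).wp n W (fun τ => Inv M b Δ D' τ ∧
      Linked M b τ.mem = Linked M b σ.mem ∧ ∀ k < 15, τ.reg k = σ.reg k) σ := by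
  have hxM : x < M := by have := hx.1; have := hI.header.le; omega
  have hf' : f ≠ 15 := by omega
  have l₀ := hx.loc (s := 0) (by omega)
  rw [zero_mul, add_zero] at l₀
  simp only [clearBlock, Code.wp]
  refine Code.wp_mono (wp_setCell hM hI (x := x) (s := 0) (j := x) (by omega) hfx hxM (by omega)
    (by omega) (by rwa [hfx])) ?_
  rintro τ₁ ⟨I₁, L₁, r₁, -⟩
  rw [hI.reg_five] at I₁
  simp only [r₁ _ (by omega : f < 20), hfx, I₁.reg_three]
  refine ⟨by omega, ?_⟩
  refine Code.wp_mono (wp_setCell hM (I₁.set (by omega)) (x := x) (s := 1) (j := x + M) (by omega)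
    (by simp [hf', r₁ _ (by omega : f < 20), hfx]) hxM (by omega) (by omega)
    (by simpa using (hx.of_eq L₁).loc (s := 1) (by omega))) ?_
  rintro τ₂ ⟨I₂, L₂, r₂, -⟩
  simp only [State.set_reg, State.set_mem, Nat.reduceEqDiff, reduceIte, I₁.reg_five] at I₂ L₂ r₂
  rw [L₁] at L₂
  simp only [r₂ _ (by omega : 15 < 20), reduceIte, I₂.reg_three]
  refine ⟨by omega, ?_⟩
  refine Code.wp_mono (wp_setCell hM (I₂.set (by omega)) (x := x) (s := 2) (j := x + M + M)
    (by omega) (by simp [hf', r₂ _ (by omega : f < 20), r₁ _ (by omega : f < 20), hfx]) hxM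
    (by omega) (by omega)
    (by simpa [two_mul, add_assoc] using (hx.of_eq L₂).loc (s := 2) (by omega))) ?_
  rintro τ₃ ⟨I₃, L₃, r₃, -⟩
  simp only [State.set_reg, State.set_mem, Nat.reduceEqDiff, reduceIte, I₂.reg_five] at I₃ L₃ r₃
  rw [L₂] at L₃
  simp only [r₃ _ (by omega : 15 < 20), reduceIte, I₃.reg_three]
  refine ⟨by omega, ?_⟩
  refine Code.wp_mono (wp_setCell hM (I₃.set (by omega)) (x := x) (s := 3) (j := x + M + M + M)
    (by omega) (by simp [hf', r₃ _ (by omega : f < 20), r₂ _ (by omega : f < 20),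
      r₁ _ (by omega : f < 20), hfx]) hxM (by omega) (by omega)
    (by simpa [show 3 * M = M + (M + M) by omega, add_assoc] using
      (hx.of_eq L₃).loc (s := 3) (by omega))) ?_
  rintro τ₄ ⟨I₄, L₄, r₄, -⟩
  simp only [State.set_reg, State.set_mem, Nat.reduceEqDiff, reduceIte, I₃.reg_five] at I₄ L₄ r₄
  rw [L₃] at L₄
  refine ⟨I₄.congr fun j => ?_, L₄, fun k hk => ?_⟩
  · simp only [Function.update_apply]
    split_ifs with e₁ e₂ e₃ e₄
    · rw [e₁, ← h₁ 3 (by omega)]; congr 1; omega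
    · rw [e₂, ← h₁ 2 (by omega)]; congr 1; omega
    · rw [e₃, ← h₁ 1 (by omega)]; congr 1; omega
    · rw [e₄, ← h₁ 0 (by omega)]; congr 1; omega
    · refine h₂ j fun s hs => ?_
      interval_cases s <;> omega
  · rw [r₄ k (by omega), if_neg (by omega), r₃ k (by omega), if_neg (by omega), r₂ k (by omega),
      if_neg (by omega), r₁ k (by omega)]

/-- Each slot is read after other slots have been written, but cells in different slots are
distinct, and the repairs touch only pointer cells. So the original source values are copied. -/
theorem wp_copyCells (hM : 4 * M < n) (hW : n ≤ W) (hI : Inv M b Δ D σ) {y z x u : ℕ}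
    (hy : y < 15) (hz : z < 15) (hyx : σ.reg y = x) (hzu : σ.reg z = u) (hx : Home M b σ.mem x)
    (hu : u < M) {D' : ℕ → ℕ}
    (h₁ : ∀ s, 1 ≤ s → s < 4 → D' (x + s * M) = σ.mem (u + s * M))
    (h₂ : ∀ j, (∀ s, 1 ≤ s → s < 4 → j ≠ x + s * M) → D' j = D j) :
    (copyCells y z).wp n W (fun τ => Inv M b Δ D' τ ∧
      Linked M b τ.mem = Linked M b σ.mem ∧ (∀ k < 15, τ.reg k = σ.reg k)) σ := by
  have hxM : x < M := by have := hx.1; have := hI.header.le; omega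
  have y5 : y ≠ 15 := by omega
  have y6 : y ≠ 16 := by omega
  have y7 : y ≠ 17 := by omega
  have z5 : z ≠ 15 := by omega
  have hy20 : y < 20 := by omega
  have hz20 : z < 20 := by omega
  simp only [copyCells, Code.wp, State.set_reg, State.set_mem, Nat.reduceEqDiff, reduceIte,
    z5, hyx, hzu, hI.reg_three]
  refine ⟨by omega, by omega, by omega, ?_⟩
  refine Code.wp_mono (wp_setCell hM (((hI.set (by omega)).set (by omega)).set (by omega))
    (x := x) (s := 1) (j := x + M) hy20 (by simp [y5, y6, y7, hyx]) hxM (by omega)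
    (by omega) (by simpa using hx.loc (s := 1) (by omega))) ?_
  rintro τ₁ ⟨I₁, L₁, r₁, m₁⟩
  simp only [State.set_reg, State.set_mem, Nat.reduceEqDiff, reduceIte] at I₁ L₁ r₁ m₁
  simp only [Nat.reduceEqDiff, reduceIte, I₁.reg_three,
    r₁ 15 (by omega), r₁ 16 (by omega)]
  refine ⟨by omega, by omega, by omega, ?_⟩
  refine Code.wp_mono (wp_setCell hM (((I₁.set (by omega)).set (by omega)).set (by omega))
    (x := x) (s := 2) (j := x + M + M) hy20 (by simp [y5, y6, y7, r₁ _ hy20, hyx]) hxM (by omega)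
    (by omega) (by simpa [two_mul, add_assoc] using (hx.of_eq L₁).loc (s := 2) (by omega))) ?_
  rintro τ₂ ⟨I₂, L₂, r₂, m₂⟩
  simp only [State.set_reg, State.set_mem, Nat.reduceEqDiff, reduceIte] at I₂ L₂ r₂ m₂
  rw [L₁] at L₂
  simp only [Nat.reduceEqDiff, reduceIte, I₂.reg_three,
    r₂ 15 (by omega), r₂ 16 (by omega)]
  refine ⟨by omega, by omega, by omega, ?_⟩
  refine Code.wp_mono (wp_setCell hM (((I₂.set (by omega)).set (by omega)).set (by omega))
    (x := x) (s := 3) (j := x + M + M + M) hy20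
    (by simp [y5, y6, y7, r₂ _ hy20, r₁ _ hy20, hyx]) hxM (by omega)
    (by omega) (by simpa [show 3 * M = M + (M + M) by omega, add_assoc] using
      (hx.of_eq L₂).loc (s := 3) (by omega))) ?_
  rintro τ₃ ⟨I₃, L₃, r₃, m₃⟩
  simp only [State.set_reg, State.set_mem, Nat.reduceEqDiff, reduceIte] at I₃ L₃ r₃ m₃
  rw [L₂] at L₃
  refine ⟨I₃.congr fun j => ?_, L₃, fun k hk => ?_⟩
  · rw [m₂ _ (by omega), m₁ _ (by omega), m₁ _ (by omega), if_neg (by omega), if_neg (by omega),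
      if_neg (by omega)]
    simp only [Function.update_apply]
    split_ifs with e₁ e₂ e₃
    · rw [e₁, show x + M + M + M = x + 3 * M by omega, h₁ 3 (by omega) (by omega)]
      congr 1; omega
    · rw [e₂, show x + M + M = x + 2 * M by omega, h₁ 2 (by omega) (by omega)]
      congr 1; omega
    · rw [e₃, show x + M = x + 1 * M by omega, h₁ 1 (by omega) (by omega)]
      congr 1; omega
    · refine h₂ j fun s h1 hs => ?_
      interval_cases s <;> omega
  · rw [r₃ k (by omega), if_neg (by omega), if_neg (by omega), if_neg (by omega), r₂ k (by omega),
      if_neg (by omega), if_neg (by omega), if_neg (by omega), r₁ k (by omega),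
      if_neg (by omega), if_neg (by omega), if_neg (by omega)]

/-- Move the border up by one. -/
def raise : Code :=
  .const 10 1 ;; .add 4 4 10 ;;
  .ite (.lt 4 3) (.sub 11 3 10 ;; .add 11 11 3 ;; .store 11 4) (.setBit true)

theorem wp_raise (hM : 4 * M < n) (hW : n ≤ W) (hI : Inv M b Δ D σ) (hb : b < M)
    (hg : σ.mem b ≤ b) {D' : ℕ → ℕ} (h₁ : ∀ s < 4, D' (b + s * M) = σ.mem (b + s * M))
    (h₂ : ∀ z, Linked M b σ.mem b z → ∀ s < 4, D' (z + s * M) = σ.mem (z + s * M))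
    (h₃ : ∀ j, (∀ s < 4, j ≠ b + s * M) →
      (∀ z, Linked M b σ.mem b z → ∀ s < 4, j ≠ z + s * M) → D' j = D j) :
    raise.wp n W (fun τ => Inv M (b + 1) Δ D' τ ∧
      (∀ i k, Linked M (b + 1) τ.mem i k ↔ Linked M b σ.mem i k ∧ i ≠ b) ∧
      (∀ k < 10, k ≠ 4 → τ.reg k = σ.reg k) ∧ τ.mem = bump M b σ.mem) σ := by
  have e₁ : 1 % W = 1 := Nat.mod_eq_of_lt (by omega)
  suffices key : ∀ Q : State → Prop, (∀ τ : State, τ.reg 4 = b + 1 →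
      (∀ k < 10, k ≠ 4 → τ.reg k = σ.reg k) → τ.bit = (if b + 1 < M then σ.bit else true) →
      τ.mem = bump M b σ.mem → Q τ) → raise.wp n W Q σ by
    refine key _ fun τ h4 hr hbit hm => ⟨⟨?_, h4, ?_, ?_, ?_⟩, ?_, hr, hm⟩
    · rw [hr _ (by norm_num) (by norm_num), hI.reg_three]
    · rw [hr _ (by norm_num) (by norm_num), hI.reg_five]
    · rw [hm, hbit]; exact hI.header.bump hb hg
    · rw [hm]; exact hI.repr.bump hb hg h₁ h₂ h₃
    · rw [hm]; exact fun i k => linked_bump hb hg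
  intro Q hQ
  simp only [raise, Code.wp, Test.HoldsIn, State.set_reg, reduceIte, Nat.reduceEqDiff, hI.reg_three, hI.reg_four, e₁]
  refine ⟨by omega, fun h => ⟨by omega, by omega, by omega, hQ _ ?_ ?_ ?_ ?_⟩,
    fun h => hQ _ ?_ ?_ ?_ ?_⟩
  · simp
  · intro k hk hk'
    simp only [State.put_reg, State.set_reg]
    rw [if_neg (by omega), if_neg (by omega), if_neg (by omega), if_neg (by omega)]
  · simp [h]
  · simp [bump, h]
    congr 1; omega
  · simp
  · intro k hk hk'
    simp only [State.mark_reg, State.set_reg]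
    rw [if_neg (by omega), if_neg (by omega)]
  · simp [h]
  · simp [bump, h]

end

open Classical in
/-- The array `D` with the entries of block `x` replaced by the cells of `g`. -/
noncomputable def patch (M : ℕ) (g D : ℕ → ℕ) (x : ℕ) : ℕ → ℕ :=
  fun j => if ∃ s < 4, j = x + s * M then g j else D j

theorem patch_self {M : ℕ} {g D : ℕ → ℕ} {x s : ℕ} (hs : s < 4) :
    patch M g D x (x + s * M) = g (x + s * M) :=
  if_pos ⟨s, hs, rfl⟩

theorem patch_of_ne {M : ℕ} {g D : ℕ → ℕ} {x j : ℕ} (h : ∀ s < 4, j ≠ x + s * M) :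
    patch M g D x j = D j :=
  if_neg fun ⟨s, hs, e⟩ => h s hs e

theorem patch_of_block_ne {M : ℕ} {g D : ℕ → ℕ} {x y s : ℕ} (hx : x < M) (hy : y < M)
    (h : y ≠ x) : patch M g D x (y + s * M) = D (y + s * M) :=
  patch_of_ne fun _ _ e => h (slot_inj hy hx e).1

/-- Make the unlinked block `R[7]` at the border a cleared block below the border. -/
def absorbFree : Code :=
  .store 7 7 ;; raise ;; .move 9 7 ;; clearBlock 9

/-- Bring the entries of the block `R[7]` at the border home from the block `R[8]`, which is
cleared. -/
def absorbLinked : Code :=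
  raise ;; .add 14 7 3 ;; .add 14 14 3 ;; .add 14 14 3 ;; .load 14 14 ;; setCell 7 7 14 ;;
  copyCells 7 8 ;; .move 9 8 ;; clearBlock 9

/-- Move the border up by one, and return in `R[9]` a block below the border that has been
cleared. -/
def absorb : Code :=
  .move 7 4 ;; .load 8 7 ;;
  .ite (.lt 8 4) (.load 9 8 ;; .ite (.eq 9 7) absorbLinked absorbFree) absorbFree

/-- Activate the block `R[6]` with the help of the cleared block `R[9]`. -/
def activate : Code :=
  .ite (.lt 6 4)
    (.load 10 6 ;; .ite (.lt 10 4) .skip (.ite (.lt 10 3)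
      (.load 11 10 ;; .ite (.eq 11 6)
        (copyCells 9 6 ;; .store 9 10 ;; .store 10 9 ;; clearBlock 6) .skip) .skip))
    (.add 12 6 3 ;; .add 12 12 3 ;; .add 12 12 3 ;; .store 12 5 ;; .store 9 6 ;; .store 6 9)

/-- Run `p` with the active cell of the entry `R[1]` in `R[7]`, or `q` if its block `R[6]` is not
active. -/
def locate (p q : Code) : Code :=
  .load 20 6 ;;
  .ite (.lt 6 4)
    (.move 7 1 ;; .ite (.lt 20 4) p (.ite (.lt 20 3) (.load 21 20 ;; .ite (.eq 21 6) q p) p))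
    (.ite (.lt 20 4)
      (.load 21 20 ;; .ite (.eq 21 6)
        (.ite (.lt 1 3) (.add 7 1 3 ;; .add 7 7 3 ;; .add 7 7 3) (.sub 7 1 6 ;; .add 7 7 20) ;; p)
        q)
      q)

/-! ### Correctness of `absorb`, `activate` and `locate`. -/

section

variable {n W M b Δ : ℕ} {D : ℕ → ℕ} {σ : State}

/-- What `absorb` achieves. -/
def Absorbed (M b Δ : ℕ) (D : ℕ → ℕ) (σ τ : State) : Prop :=
  Inv M (b + 1) Δ D τ ∧ Home M (b + 1) τ.mem (τ.reg 9) ∧ (∀ s < 4, D (τ.reg 9 + s * M) = Δ) ∧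
    (∀ i k, Linked M (b + 1) τ.mem i k → Linked M b σ.mem i k) ∧
    ∀ k < 7, k ≠ 4 → τ.reg k = σ.reg k

theorem wp_absorbFree (hM : 4 * M < n) (hW : n ≤ W) (hI : Inv M b Δ D σ) (hb : b < M)
    (h7 : σ.reg 7 = b) (hL : ∀ k, ¬ Linked M b σ.mem b k) :
    absorbFree.wp n W (Absorbed M b Δ D σ) σ := by
  have hA : ¬ Active M b σ.mem b := by
    rintro (h | ⟨k, h⟩)
    · have := h.1; omega
    · exact hL k h
  have hL' := linked_update_self le_rfl hL
  -- Pointing block `b` to itself gives the bound on its pointer that moving the border requires.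
  have I₀ : Inv M b Δ D (σ.put b b) :=
    ⟨hI.reg_three, hI.reg_four, hI.reg_five, hI.header.update_self le_rfl hb hL,
      hI.repr.update_self hb.le le_rfl hb hL⟩
  simp only [absorbFree, Code.wp, h7]
  refine ⟨by omega, ?_⟩
  refine Code.wp_mono (wp_raise hM hW I₀ hb (by simp)
    (D' := patch M (σ.put b b).mem D b) (fun s hs => patch_self hs) ?_ ?_) ?_
  · intro z hz
    rw [State.put_mem, hL'] at hz
    exact (hL z hz).elim
  · exact fun j h _ => patch_of_ne h
  rintro τ ⟨I₁, L₁, r₁, -⟩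
  have hτ : τ.reg 7 = b := by rw [r₁ 7 (by omega) (by omega), State.put_reg, h7]
  simp only [hτ]
  have hH : Home M (b + 1) τ.mem b := ⟨by omega, fun i hi => by
    have := ((L₁ i b).1 hi).1.2.2.1; omega⟩
  refine Code.wp_mono (wp_clearBlock hM hW (I₁.set (by omega)) (x := b) (by omega) (by simp) hH
    (fun s hs => hI.repr.default b s hb hs hA) fun j h => (patch_of_ne h).symm) ?_
  rintro υ ⟨I₂, L₂, r₂⟩
  have hυ : υ.reg 9 = b := by rw [r₂ 9 (by omega)]; simp
  refine ⟨I₂, ?_, ?_, ?_, ?_⟩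
  · rw [hυ]; exact hH.of_eq L₂
  · rw [hυ]; exact fun s hs => hI.repr.default b s hb hs hA
  · intro i k h
    rw [L₂] at h
    have := ((L₁ i k).1 h).1
    rwa [State.put_mem, hL'] at this
  · intro k hk hk'
    rw [r₂ k (by omega), State.set_reg, if_neg (by omega), r₁ k (by omega) hk', State.put_reg]

/-- Moving the border leaves the entries of block `b` scattered over `b` and its lender `z`. Once
they are gathered in `b`, block `z` is free; it was inactive, so clearing it to `Δ` restores `D`. -/
theorem wp_absorbLinked (hM : 4 * M < n) (hW : n ≤ W) (hI : Inv M b Δ D σ) (hb : b < M)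
    (h7 : σ.reg 7 = b) {z : ℕ} (h8 : σ.reg 8 = z) (hL : Linked M b σ.mem b z) :
    absorbLinked.wp n W (Absorbed M b Δ D σ) σ := by
  have hzb : z < b := hL.2.2.1
  have hzM : z < M := by omega
  have hg : σ.mem b ≤ b := by have := hL.2.2.2.1; omega
  have hΔ : ∀ s < 4, D (z + s * M) = Δ := fun s hs => hI.repr.default z s hzM hs hL.not_active
  simp only [absorbLinked, Code.wp]
  refine Code.wp_mono (wp_raise hM hW hI hb hg
    (D' := patch M σ.mem (patch M σ.mem D b) z) ?_ ?_ ?_) ?_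
  · intro s hs
    rw [patch_of_block_ne hzM hb (by omega), patch_self hs]
  · intro z' hz' s hs
    rw [hz'.right_inj hL, patch_self hs]
  · intro j h₁ h₂
    rw [patch_of_ne (h₂ z hL), patch_of_ne h₁]
  rintro τ ⟨I₁, L₁, r₁, m₁⟩
  have h7' : τ.reg 7 = b := by rw [r₁ 7 (by omega) (by omega), h7]
  have h8' : τ.reg 8 = z := by rw [r₁ 8 (by omega) (by omega), h8]
  have hHb : Home M (b + 1) τ.mem b := ⟨by omega, fun i hi => by
    have := ((L₁ i b).1 hi).1.2.2.1; omega⟩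
  have hHz : Home M (b + 1) τ.mem z := ⟨by omega, fun i hi =>
    ((L₁ i z).1 hi).2 (((L₁ i z).1 hi).1.left_inj hL)⟩
  have lb := hHb.loc (s := 0) (by omega)
  rw [zero_mul, add_zero] at lb
  -- Entry `0` of block `b` still sits in its slot `3`; it must be rescued before `copyCells`
  -- overwrites that slot.
  have hv : τ.mem (b + M + M + M) = D b := by
    rw [m₁, bump_apply (by omega), hI.repr.loc _ _ hL.loc_zero]
    congr 1; omega
  simp only [State.set_reg, State.set_mem, Nat.reduceEqDiff, reduceIte, h7', I₁.reg_three]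
  refine ⟨by omega, by omega, by omega, by omega, ?_⟩
  refine Code.wp_mono (wp_setCell hM ((((I₁.set (by omega)).set (by omega)).set (by omega)).set
    (by omega)) (x := b) (s := 0) (j := b) (by omega) (by simp [h7']) hb (by omega) (by omega)
    (by simpa [h7'] using lb)) ?_
  rintro τ₂ ⟨I₂, L₂, r₂, m₂⟩
  simp only [State.set_reg, State.set_mem, Nat.reduceEqDiff, reduceIte, h7', hv] at I₂ L₂ r₂ m₂
  have h7₂ : τ₂.reg 7 = b := by rw [r₂ 7 (by omega)]; simp [h7']
  have h8₂ : τ₂.reg 8 = z := by rw [r₂ 8 (by omega)]; simp [h8']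
  refine Code.wp_mono (wp_copyCells hM hW I₂ (by omega) (by omega) h7₂ h8₂ (hHb.of_eq L₂) hzM
    (D' := patch M σ.mem D z) ?_ ?_) ?_
  · intro s h1 hs
    -- As `z < b < M`, block `z` is not the last one, so the updated border was not written into its
    -- cells.
    have hs' : z + s * M ≠ 2 * M - 1 ∧ M ≤ z + s * M := by interval_cases s <;> omega
    rw [m₂ _ hs'.2, if_neg (by omega), m₁, bump_apply hs'.1, patch_of_block_ne hzM hb (by omega),
      hI.repr.loc _ _ (hL.loc h1 hs)]
  · intro j h
    by_cases hj : j = b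
    · subst hj
      have := @patch_of_block_ne M σ.mem D z j 0 hzM hb (by omega)
      simpa using this
    · rw [Function.update_of_ne hj]
      have hjb : ∀ s < 4, j ≠ b + s * M := by
        intro s hs
        rcases Nat.eq_zero_or_pos s with rfl | h1
        · omega
        · exact h s h1 hs
      unfold patch
      split_ifs with h₁ h₂
      · rfl
      · exact (hjb _ h₂.choose_spec.1 h₂.choose_spec.2).elim
      · rfl
  rintro τ₃ ⟨I₃, L₃, r₃⟩
  rw [L₂] at L₃
  have h8₃ : τ₃.reg 8 = z := by rw [r₃ 8 (by omega), h8₂]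
  simp only [h8₃]
  refine Code.wp_mono (wp_clearBlock hM hW (I₃.set (by omega)) (x := z) (by omega) (by simp)
    (hHz.of_eq L₃) hΔ fun j h => (patch_of_ne h).symm) ?_
  rintro υ ⟨I₄, L₄, r₄⟩
  rw [State.set_mem, L₃] at L₄
  have hυ : υ.reg 9 = z := by rw [r₄ 9 (by omega)]; simp
  refine ⟨I₄, ?_, ?_, ?_, ?_⟩
  · rw [hυ]; exact hHz.of_eq L₄
  · rwa [hυ]
  · intro i k h
    rw [L₄] at h
    exact ((L₁ i k).1 h).1
  · intro k hk hk'
    rw [r₄ k (by omega), State.set_reg, if_neg (by omega), r₃ k (by omega), r₂ k (by omega),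
      if_neg (by omega), if_neg (by omega), if_neg (by omega), if_neg (by omega),
      r₁ k (by omega) hk']

theorem wp_absorb (hM : 4 * M < n) (hW : n ≤ W) (hI : Inv M b Δ D σ) (hb : b < M) :
    absorb.wp n W (Absorbed M b Δ D σ) σ := by
  simp only [absorb, Code.wp, Test.HoldsIn, State.set_reg, State.set_mem, Nat.reduceEqDiff,
    reduceIte, hI.reg_four]
  refine ⟨by omega, fun h₁ => ⟨by omega, fun h₂ => ?_, fun h₂ => ?_⟩, fun h₁ => ?_⟩
  · refine Code.wp_mono (wp_absorbLinked hM hW (((hI.set (by omega)).set (by omega)).set (by omega))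
      hb (by simp) (z := σ.mem b) (by simp) ⟨le_rfl, hb, h₁, rfl, h₂⟩) ?_
    rintro τ ⟨t₁, t₂, t₃, t₄, t₅⟩
    refine ⟨t₁, t₂, t₃, t₄, fun k hk hk' => ?_⟩
    simp only [t₅ k hk hk', State.set_reg]
    rw [if_neg (by omega), if_neg (by omega), if_neg (by omega)]
  · refine Code.wp_mono (wp_absorbFree hM hW (((hI.set (by omega)).set (by omega)).set (by omega))
      hb (by simp) ?_) ?_
    · rintro k ⟨-, -, -, hk, hk'⟩
      simp only [State.set_mem] at hk hk'
      rw [← hk] at hk'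
      exact h₂ hk'
    rintro τ ⟨t₁, t₂, t₃, t₄, t₅⟩
    refine ⟨t₁, t₂, t₃, t₄, fun k hk hk' => ?_⟩
    simp only [t₅ k hk hk', State.set_reg]
    rw [if_neg (by omega), if_neg (by omega), if_neg (by omega)]
  · refine Code.wp_mono (wp_absorbFree hM hW ((hI.set (by omega)).set (by omega)) hb (by simp) ?_) ?_
    · rintro k ⟨-, -, hk'', hk, hk'⟩
      simp only [State.set_mem] at hk hk'
      omega
    rintro τ ⟨t₁, t₂, t₃, t₄, t₅⟩
    refine ⟨t₁, t₂, t₃, t₄, fun k hk hk' => ?_⟩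
    simp only [t₅ k hk hk', State.set_reg]
    rw [if_neg (by omega), if_neg (by omega)]

/-- If `x` is a lender, `f` takes over its duty and `x` returns home, cleared. If `x` is above the
border, it borrows `f`, whose slots already hold the fill value. Otherwise `x` is at home, possibly
as a result of `absorb`. -/
theorem wp_activate (hM : 4 * M < n) (hW : n ≤ W) (hI : Inv M b Δ D σ) {x f : ℕ} (hx : x < M)
    (h6 : σ.reg 6 = x) (h9 : σ.reg 9 = f) (hf : Home M b σ.mem f) (hΔ : ∀ s < 4, D (f + s * M) = Δ)
    (hL : b ≤ x → ∀ k, ¬ Linked M b σ.mem x k) :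
    activate.wp n W (fun τ => Inv M b Δ D τ ∧ Active M b τ.mem x ∧ ∀ k < 7, τ.reg k = σ.reg k)
      σ := by
  have hb := hI.header.le
  have hfb := hf.1
  simp only [activate, Code.wp, Test.HoldsIn, State.set_reg, State.set_mem, Nat.reduceEqDiff,
    reduceIte, hI.reg_three, hI.reg_four, hI.reg_five, h6, h9, State.put_reg, State.put_mem]
  have home : x < b → ¬ (b ≤ σ.mem x ∧ σ.mem x < M ∧ σ.mem (σ.mem x) = x) →
      Active M b σ.mem x := by
    rintro h₁ h₂
    refine .inl ⟨h₁, ?_⟩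
    rintro i ⟨h₃, h₄, -, h₅, rfl⟩
    exact h₂ ⟨h₃, h₄, by rw [h₅]⟩
  refine ⟨fun h₁ => ⟨by omega, fun h₂ => ?_, fun h₂ => ⟨fun h₃ => ⟨by omega, fun h₄ => ?_,
    fun h₄ => ?_⟩, fun h₃ => ?_⟩⟩, fun h₁ => ⟨by omega, by omega, by omega, by omega, by omega,
    by omega, ?_⟩⟩
  · refine ⟨hI.set (by omega), home h₁ (by omega), fun k hk => ?_⟩
    rw [if_neg (by omega)]
  · set p := σ.mem x with hp
    have hpx : Linked M b σ.mem p x := ⟨not_lt.1 h₂, h₃, h₁, h₄, rfl⟩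
    have hxf : x ≠ f := fun e => hf.2 p (e ▸ hpx)
    classical
    -- While `f` still counts as being at home, the data copied for `p` appear as entries of `f`;
    -- `D₁` is the array represented at this stage.
    let D₁ : ℕ → ℕ := fun j => if ∃ s, 1 ≤ s ∧ s < 4 ∧ j = f + s * M then σ.mem (x + (j - f))
      else D j
    have hD₁ : ∀ s, 1 ≤ s → s < 4 → D₁ (f + s * M) = σ.mem (x + s * M) := by
      intro s h1 hs
      simp only [D₁]
      rw [if_pos ⟨s, h1, hs, rfl⟩, Nat.add_sub_cancel_left]
    have hD₁' : ∀ j, (∀ s, 1 ≤ s → s < 4 → j ≠ f + s * M) → D₁ j = D j :=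
      fun j h => if_neg fun ⟨s, h1, hs, e⟩ => h s h1 hs e
    refine Code.wp_mono (wp_copyCells hM hW ((hI.set (by omega)).set (by omega)) (by omega)
      (by omega) (x := f) (u := x) (D' := D₁) (by simp [h9]) (by simp [h6]) hf hx hD₁ hD₁') ?_
    rintro τ ⟨I₁, L₁, r₁⟩
    simp only [State.set_reg, State.set_mem] at L₁ r₁
    have h9' : τ.reg 9 = f := by simp [r₁, h9]
    have h10' : τ.reg 10 = p := by simp [r₁]
    simp only [h9', h10']
    refine ⟨by omega, by omega, ?_⟩
    have hm : ((τ.put f p).put p f).mem = link τ.mem p f := rfl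
    have hf' := hf.of_eq L₁
    have hpb := hpx.1
    have hpx' : Linked M b τ.mem p x := by rwa [L₁]
    have I₂ : Inv M b Δ (patch M τ.mem D x) ((τ.put f p).put p f) := by
      refine ⟨I₁.reg_three, I₁.reg_four, I₁.reg_five, I₁.header.link hpb h₃ hf', ?_⟩
      refine I₁.repr.link hb hpb h₃ hf' ?_ ?_ ?_ ?_ ?_ ?_
      · intro s hs
        rw [patch_of_block_ne hx (by omega) hxf.symm, hΔ s hs]
      · rw [← I₁.repr.loc _ _ hpx'.loc_zero, hD₁']
        · have := @patch_of_block_ne M τ.mem D x p 0 hx h₃ (by omega)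
          simpa using this
        · intro s h1 hs
          interval_cases s <;> omega
      · intro s h1 hs
        rw [patch_of_block_ne hx h₃ (by omega), hI.repr.loc _ _ (hpx.loc h1 hs), ← hD₁ s h1 hs,
          I₁.repr.loc _ _ (hf'.loc hs)]
      · intro x' hx' s hs
        rw [hx'.right_inj hpx', patch_self hs]
      · intro y s hy hs hyf hyp hpy
        rw [patch_of_block_ne hx hy (by rintro rfl; exact hpy hpx'), hD₁']
        intro t h1 ht e
        exact hyf (slot_inj hy (by omega) e).1
      · intro j hj
        rw [patch_of_ne, hD₁']
        · intro s h1 hs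
          have := slot_lt (show f < M by omega) hs; omega
        · intro s hs
          have := slot_lt hx hs; omega
    have hxH : Home M b ((τ.put f p).put p f).mem x := by
      refine ⟨h₁, fun i hi => ?_⟩
      rw [hm, linked_link hpb h₃ hf'] at hi
      obtain ⟨-, h⟩ | ⟨hip, h⟩ := hi
      · exact hxf h
      · exact hip (h.left_inj hpx')
    refine Code.wp_mono (wp_clearBlock hM hW I₂ (x := x) (by omega) (by simp [r₁, h6]) hxH
      (D' := D) (fun s hs => hI.repr.default x s hx hs hpx.not_active)
      fun j h => (patch_of_ne h).symm) ?_
    rintro υ ⟨I₃, L₃, r₃⟩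
    refine ⟨I₃, .inl (hxH.of_eq L₃), fun k hk => ?_⟩
    rw [r₃ k (by omega), State.put_reg, State.put_reg, r₁ k (by omega), if_neg (by omega),
      if_neg (by omega)]
  · refine ⟨(hI.set (by omega)).set (by omega), home h₁ (by omega), fun k hk => ?_⟩
    rw [if_neg (by omega), if_neg (by omega)]
  · refine ⟨hI.set (by omega), home h₁ (by omega), fun k hk => ?_⟩
    rw [if_neg (by omega)]
  · have hL := hL (not_lt.1 h₁)
    have hA : ¬ Active M b σ.mem x := by
      rintro (h | ⟨k, h⟩)
      · exact h₁ h.1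
      · exact hL k h
    -- Slot `3` of `x` will store its entry `0`. It can be filled before linking, since an unlinked
    -- upper block stores nothing.
    set g₁ := Function.update σ.mem (x + M + M + M) Δ with hg₁
    have e₁ : ∀ c < M, g₁ c = σ.mem c := fun c hc => Function.update_of_ne (by omega) _ _
    have L₁ : Linked M b g₁ = Linked M b σ.mem := by
      ext i k
      unfold Linked
      refine and_congr_right fun h₁ => and_congr_right fun h₂ => and_congr_right fun h₃ => ?_
      rw [e₁ i h₂, e₁ k (by omega)]
    have R₁ : Repr M b Δ g₁ D := by
      refine .congr L₁ (fun j a h => ?_) hI.repr.default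
      rw [hg₁, Function.update_of_ne, hI.repr.loc _ _ h]
      obtain ⟨h, rfl⟩ | ⟨x', s, y, t, hx', hs, hy, ht, rfl, rfl, c⟩ := h.cases hb
      · omega
      · intro e
        obtain ⟨rfl, rfl⟩ := slot_inj hy hx (show y + t * M = x + 3 * M by omega)
        rcases c with ⟨c, rfl, rfl⟩ | ⟨c, c1, rfl⟩ | ⟨⟨k, c⟩, rfl, rfl, e⟩
        · exact h₁ c.1
        · exact h₁ c.2.2.1
        · exact hL k c
    have H₁ : Header M σ.bit g₁ b Δ := hI.header.congr L₁ fun h => by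
      rw [hg₁, Function.update_of_ne (by omega), Function.update_of_ne (by omega)]
      exact ⟨rfl, rfl⟩
    have hf' := hf.of_eq L₁
    have hd : ∀ s < 4, D (x + s * M) = Δ := fun s hs => hI.repr.default x s hx hs hA
    have R₂ : Repr M b Δ (link g₁ x f) D := by
      refine R₁.link hb (not_lt.1 h₁) hx hf' hΔ ?_ ?_ ?_ ?_ fun _ _ => rfl
      · have := hd 0 (by omega)
        rw [zero_mul, add_zero] at this
        rw [this, show x + 3 * M = x + M + M + M by omega, hg₁, Function.update_self]
      · intro s h1 hs
        rw [hd s hs, ← R₁.loc _ _ (hf'.loc hs), hΔ s hs]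
      · intro y hy
        rw [L₁] at hy
        exact (hL y hy).elim
      · exact fun _ _ _ _ _ _ _ => rfl
    refine ⟨⟨?_, ?_, ?_, H₁.link (not_lt.1 h₁) hx hf', R₂⟩, .inr ⟨f, ?_⟩, fun k hk => ?_⟩
    · simp [hI.reg_three]
    · simp [hI.reg_four]
    · simp [hI.reg_five]
    · exact (linked_link (not_lt.1 h₁) hx hf').2 (.inl ⟨rfl, rfl⟩)
    · rw [if_neg (by omega), if_neg (by omega), if_neg (by omega)]

theorem wp_locate (hM : 4 * M < n) (hW : n ≤ W) (hI : Inv M b Δ D σ) {x s : ℕ} (hx : x < M)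
    (hs : s < 4) (h1 : σ.reg 1 = x + s * M) (h6 : σ.reg 6 = x) {p q : Code} {Q : State → Prop}
    (hp : ∀ τ, Inv M b Δ D τ → τ.mem = σ.mem → (∀ k < 7, τ.reg k = σ.reg k) →
      Loc M b τ.mem (x + s * M) (τ.reg 7) → p.wp n W Q τ)
    (hq : ∀ τ, Inv M b Δ D τ → τ.mem = σ.mem → (∀ k < 7, τ.reg k = σ.reg k) →
      ¬ Active M b τ.mem x → q.wp n W Q τ) :
    (locate p q).wp n W Q σ := by
  have hb := hI.header.le
  have hlt := slot_lt hx hs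
  simp only [locate, Code.wp, Test.HoldsIn, State.set_reg, State.set_mem, Nat.reduceEqDiff,
    reduceIte, hI.reg_three, hI.reg_four, h1, h6]
  have home : x < b → ¬ (b ≤ σ.mem x ∧ σ.mem x < M ∧ σ.mem (σ.mem x) = x) →
      Home M b σ.mem x := by
    rintro h₁ h₂
    refine ⟨h₁, ?_⟩
    rintro i ⟨h₃, h₄, -, h₅, rfl⟩
    exact h₂ ⟨h₃, h₄, by rw [h₅]⟩
  have free : ¬ x < b → ¬ (σ.mem x < b ∧ σ.mem (σ.mem x) = x) → ¬ Active M b σ.mem x := by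
    rintro h₁ h₂ (h | ⟨k, -, -, h₃, h₄, h₅⟩)
    · exact h₁ h.1
    · exact h₂ ⟨by omega, by rw [h₄, h₅]⟩
  refine ⟨by omega, fun h₁ => ⟨fun h₂ => ?_, fun h₂ => ⟨fun h₃ => ⟨by omega, fun h₄ => ?_,
    fun h₄ => ?_⟩, fun h₃ => ?_⟩⟩, fun h₁ => ⟨fun h₂ => ⟨by omega, fun h₃ => ⟨fun h₄ => ?_,
    fun h₄ => ?_⟩, fun h₃ => ?_⟩, fun h₂ => ?_⟩⟩
  · refine hp _ ((hI.set (by omega)).set (by omega)) rfl (fun k hk => ?_) ?_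
    · simp only [State.set_reg]; rw [if_neg (by omega), if_neg (by omega)]
    · simpa using (home h₁ (by omega)).loc hs
  · refine hq _ (((hI.set (by omega)).set (by omega)).set (by omega)) rfl (fun k hk => ?_) ?_
    · simp only [State.set_reg]; rw [if_neg (by omega), if_neg (by omega), if_neg (by omega)]
    · exact Linked.not_active ⟨not_lt.1 h₂, h₃, h₁, h₄, rfl⟩
  · refine hp _ (((hI.set (by omega)).set (by omega)).set (by omega)) rfl (fun k hk => ?_) ?_
    · simp only [State.set_reg]; rw [if_neg (by omega), if_neg (by omega), if_neg (by omega)]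
    · simpa using (home h₁ (by omega)).loc hs
  · refine hp _ ((hI.set (by omega)).set (by omega)) rfl (fun k hk => ?_) ?_
    · simp only [State.set_reg]; rw [if_neg (by omega), if_neg (by omega)]
    · simpa using (home h₁ (by omega)).loc hs
  · have hL : Linked M b σ.mem x (σ.mem x) := ⟨not_lt.1 h₁, hx, h₂, rfl, h₃⟩
    -- An index below `M` lies in slot `0`, the one entry that is kept in the upper block itself.
    have hs0 : s = 0 := by
      by_contra h0
      have := Nat.mul_le_mul_right M (Nat.one_le_iff_ne_zero.2 h0)
      omega
    subst hs0
    refine ⟨by omega, by omega, by omega, hp _ (((((hI.set (by omega)).set (by omega)).set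
      (by omega)).set (by omega)).set (by omega)) rfl (fun k hk => ?_) ?_⟩
    · simp only [State.set_reg]
      rw [if_neg (by omega), if_neg (by omega), if_neg (by omega), if_neg (by omega),
        if_neg (by omega)]
    · have := hL.loc_zero
      simpa [show 3 * M = M + (M + M) by omega, add_assoc] using this
  · have hL : Linked M b σ.mem x (σ.mem x) := ⟨not_lt.1 h₁, hx, h₂, rfl, h₃⟩
    have hs0 : 1 ≤ s := by
      by_contra h0
      have : s = 0 := by omega
      subst this
      omega
    have := slot_lt (show σ.mem x < M by omega) hs
    refine ⟨by omega, by omega, hp _ ((((hI.set (by omega)).set (by omega)).set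
      (by omega)).set (by omega)) rfl (fun k hk => ?_) ?_⟩
    · simp only [State.set_reg]
      rw [if_neg (by omega), if_neg (by omega), if_neg (by omega), if_neg (by omega)]
    · simpa [add_comm] using hL.loc hs0 hs
  · refine hq _ ((hI.set (by omega)).set (by omega)) rfl (fun k hk => ?_) ?_
    · simp only [State.set_reg]; rw [if_neg (by omega), if_neg (by omega)]
    · exact free h₁ (by omega)
  · refine hq _ (hI.set (by omega)) rfl (fun k hk => ?_) ?_
    · simp only [State.set_reg]; rw [if_neg (by omega)]
    · exact free h₁ (by omega)

end

/-- The extra bit and the cells `g` represent the array `D`. -/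
def Represents (M : ℕ) (bit : Bool) (g D : ℕ → ℕ) : Prop :=
  ∃ b Δ, Header M bit g b Δ ∧ Repr M b Δ g D

/-- Load the number of blocks. -/
def loadBlocks : Code := .const 3 4 ;; .div 3 0 3

/-- Load the border and the default value. -/
def loadHeader : Code :=
  .ite .bit (.move 4 3)
    (.const 9 1 ;; .add 10 3 3 ;; .sub 10 10 9 ;; .load 4 10 ;; .add 10 10 3 ;; .load 5 10)

/-- Run `p` if the index `R[1]` lies in one of the blocks, and `q` otherwise. -/
def withBlocks (p q : Code) : Code :=
  loadBlocks ;; .add 8 3 3 ;; .add 8 8 8 ;;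
  .ite (.lt 1 8) (.mod 6 1 3 ;; loadHeader ;; p) q

/-- The code for `read`. -/
def readCode : Code := withBlocks (locate (.load 0 7) (.move 0 5)) (.load 0 1)

/-- Activate the block `R[6]` of the entry `R[1]`, and store `R[2]` there. -/
def writeInactive : Code := absorb ;; activate ;; locate (setCell 6 7 2) .skip

/-- The code for `write`. -/
def writeCode : Code :=
  withBlocks (locate (setCell 6 7 2) writeInactive) (.store 1 2)

/-- Decrease `R[10]` by one unless it is zero. -/
def decr : Code := .ite (.lt 8 10) (.sub 10 10 9) .skip

/-- Fill block `0` and the cells outside of the blocks, which are among the last four cells. -/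
def fillFixed : Code :=
  .move 10 0 ;; .store 10 2 ;; decr ;; .store 10 2 ;; decr ;; .store 10 2 ;; decr ;; .store 10 2 ;;
  .store 8 2 ;; .move 11 3 ;; .store 11 2 ;; .add 11 11 3 ;; .store 11 2 ;; .add 11 11 3 ;;
  .store 11 2

/-- Link block `0` to the last block, and record the header there. -/
def linkFirst : Code :=
  .sub 12 3 9 ;; .store 12 8 ;; .store 8 12 ;; .add 12 12 3 ;; .store 12 9 ;; .add 12 12 3 ;;
  .store 12 2 ;; .add 12 12 3 ;; .store 12 2 ;; .setBit false

/-- The code for `fill`. -/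
def fillCode : Code :=
  loadBlocks ;; .const 8 0 ;; .const 9 1 ;; fillFixed ;;
  .ite (.lt 9 3) linkFirst (.setBit true)

/-! ### Correctness of `read`, `write` and `fill`. -/

section

variable {n W M b Δ : ℕ} {g D : ℕ → ℕ} {σ : State}

theorem home_of_border_eq {x : ℕ} (hx : x < M) : Home M M g x :=
  ⟨hx, fun _ hi => absurd hi.2.1 (not_lt.2 hi.1)⟩

/-- With the border at `M` no block is inactive, so the default value is never consulted and need
not be stored. -/
theorem Repr.default_irrel (hD : Repr M M Δ g D) (Δ' : ℕ) : Repr M M Δ' g D :=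
  ⟨hD.loc, fun _ _ hx _ hA => (hA (.inl (home_of_border_eq hx))).elim⟩

theorem represents_true : Represents M true g g := by
  refine ⟨M, 0, .inl ⟨rfl, rfl⟩, fun j a h => ?_,
    fun _ _ hx _ hA => (hA (.inl (home_of_border_eq hx))).elim⟩
  rcases h with ⟨h, rfl⟩ | ⟨x, s, h, hs, rfl, rfl⟩ | ⟨x, k, h, rfl, rfl⟩ |
    ⟨x, k, s, h, h1, hs, rfl, rfl⟩
  · rfl
  · rfl
  · have := h.1; have := h.2.1; omega
  · have := h.1; have := h.2.1; omega

/-- A store into a cell outside of the blocks. -/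
theorem Represents.update_rest {bit : Bool} {i v : ℕ} (h : Represents M bit g D) (hi : 4 * M ≤ i) :
    Represents M bit (Function.update g i v) (Function.update D i v) := by
  obtain ⟨b, Δ, hH, hD⟩ := h
  have hb := hH.le
  have L : Linked M b (Function.update g i v) = Linked M b g := by
    ext x k
    unfold Linked
    refine and_congr_right fun h₁ => and_congr_right fun h₂ => and_congr_right fun h₃ => ?_
    rw [Function.update_of_ne (by omega), Function.update_of_ne (by omega)]
  have hl : Loc M b g i i := .inl ⟨hi, rfl⟩
  refine ⟨b, Δ, hH.congr L fun hb' => ?_, .congr L (fun j a h => ?_) fun x s hx hs hA => ?_⟩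
  · rw [Function.update_of_ne (by omega), Function.update_of_ne (by omega)]
    exact ⟨rfl, rfl⟩
  · by_cases e : j = i
    · subst e
      rw [h.unique hb hl, Function.update_self, Function.update_self]
    · rw [Function.update_of_ne e, Function.update_of_ne, hD.loc j a h]
      rintro rfl
      exact e (h.inj hb hl)
  · have := slot_lt hx hs
    rw [Function.update_of_ne (by omega), hD.default x s hx hs hA]

/-- For `w ≤ 2` the constant `4` wraps to zero, but then `n ≤ 4` and division by zero gives the
correct quotient `0`. -/
theorem div_const {w : ℕ} (hn : n ≤ 2 ^ w) : (n - 1) / (4 % 2 ^ w) = (n - 1) / 4 := by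
  by_cases hw : w ≤ 2
  · interval_cases w <;> simp at hn ⊢ <;> omega
  · have : 2 ^ 3 ≤ 2 ^ w := Nat.pow_le_pow_right (by omega) (by omega)
    rw [Nat.mod_eq_of_lt (by omega)]

theorem wp_withBlocks {w : ℕ} (hn : 1 ≤ n) (hW : n ≤ 2 ^ w) (h0 : σ.reg 0 = n - 1)
    (hM : (n - 1) / 4 = M) (hD : Represents M σ.bit σ.mem D) {p q : Code} {Q : State → Prop}
    (hp : ∀ τ x s b Δ, Inv M b Δ D τ → τ.mem = σ.mem → τ.reg 1 = σ.reg 1 → τ.reg 2 = σ.reg 2 →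
      τ.reg 6 = x → x < M → s < 4 → σ.reg 1 = x + s * M → p.wp n (2 ^ w) Q τ)
    (hq : ∀ τ, 4 * M ≤ σ.reg 1 → τ.mem = σ.mem → τ.bit = σ.bit → τ.reg 1 = σ.reg 1 →
      τ.reg 2 = σ.reg 2 → q.wp n (2 ^ w) Q τ) :
    (withBlocks p q).wp n (2 ^ w) Q σ := by
  obtain ⟨b, Δ, hH, hR⟩ := hD
  simp only [withBlocks, loadBlocks, loadHeader, Code.wp, Test.HoldsIn, State.set_reg,
    State.set_mem, State.set_bit, Nat.reduceEqDiff, reduceIte, h0, div_const hW, hM]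
  refine ⟨by omega, by omega, fun h₁ => ⟨fun h₂ => ?_, fun h₂ => ?_⟩, fun h₁ => ?_⟩
  · obtain ⟨-, rfl⟩ | h := hH
    · obtain ⟨x, s, hx, hs, e⟩ := exists_slot (show σ.reg 1 < 4 * b by omega)
      -- No default value is loaded when the bit is set, so whatever register `5` contains plays its
      -- part.
      refine hp _ x s b (σ.reg 5) ⟨?_, ?_, ?_, .inl ⟨h₂, rfl⟩, hR.default_irrel _⟩ rfl ?_ ?_ ?_ hx hs
        e <;> simp
      rw [e, Nat.add_mul_mod_self_right, Nat.mod_eq_of_lt hx]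
    · rw [h₂] at h; simp at h
  · obtain ⟨h, -⟩ | ⟨h, h', hL, hb, hΔ⟩ := id hH
    · exact (h₂ h).elim
    · obtain ⟨x, s, hx, hs, e⟩ := exists_slot (show σ.reg 1 < 4 * M by omega)
      rw [Nat.mod_eq_of_lt (show 1 < 2 ^ w by omega), ← two_mul, hb,
        show 2 * M - 1 + M = 3 * M - 1 by omega, hΔ]
      refine ⟨by omega, by omega, by omega, by omega, by omega, ?_⟩
      refine hp _ x s b Δ ⟨?_, ?_, ?_, hH, hR⟩ rfl ?_ ?_ ?_ hx hs e <;> simp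
      rw [e, Nat.add_mul_mod_self_right, Nat.mod_eq_of_lt hx]
  · refine hq _ (by omega) rfl rfl ?_ ?_ <;> simp

theorem wp_readCode {w : ℕ} (hn : 1 ≤ n) (hW : n ≤ 2 ^ w) (h0 : σ.reg 0 = n - 1)
    (h1 : σ.reg 1 < n) (hM : (n - 1) / 4 = M) (hD : Represents M σ.bit σ.mem D) :
    readCode.wp n (2 ^ w) (fun τ => Represents M τ.bit τ.mem D ∧ τ.reg 0 = D (σ.reg 1)) σ := by
  have hM' : 4 * M < n := by omega
  refine wp_withBlocks hn hW h0 hM hD ?_ ?_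
  · intro τ x s b Δ hI hm r1 r2 r6 hx hs e
    refine wp_locate hM' hW hI hx hs (by rw [r1, e]) r6 ?_ ?_
    · intro υ hI' hm' r hl
      simp only [Code.wp]
      have hb := hI'.header.le
      refine ⟨?_, ⟨b, Δ, hI'.header, hI'.repr⟩, ?_⟩
      · obtain ⟨h, h'⟩ | ⟨x', s', y, t, hx', hs', hy, ht, -, e, -⟩ := hl.cases hb
        · omega
        · have := slot_lt hy ht; omega
      · simp [e, hI'.repr.loc _ _ hl]
    · intro υ hI' hm' r hA
      refine ⟨⟨b, Δ, hI'.header, hI'.repr⟩, ?_⟩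
      simp [e, hI'.repr.default x s hx hs hA, hI'.reg_five]
  · intro τ hi hm hb r1 r2
    simp only [Code.wp, r1, hm]
    obtain ⟨b, Δ, hH, hR⟩ := hD
    refine ⟨h1, ⟨b, Δ, ?_, ?_⟩, ?_⟩
    · simpa [hb, hm] using hH
    · simpa [hm] using hR
    · simp [hR.loc _ _ (.inl ⟨hi, rfl⟩)]

/-- An inactive block forces `b < M`, so the border can move. Every link after `absorb` is an old
one, so `x` is not linked from above, as `activate` requires; afterwards `x` is active and the
second `locate` must find a cell. -/
theorem wp_writeInactive (hM : 4 * M < n) (hW : n ≤ W) (hI : Inv M b Δ D σ) {x s : ℕ}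
    (hx : x < M) (hs : s < 4) (h1 : σ.reg 1 = x + s * M) (h6 : σ.reg 6 = x)
    (hA : ¬ Active M b σ.mem x) :
    writeInactive.wp n W
      (fun τ => Represents M τ.bit τ.mem (Function.update D (x + s * M) (σ.reg 2))) σ := by
  have hb : b < M := by
    by_contra h
    have : b = M := by have := hI.header.le; omega
    subst this
    exact hA (.inl (home_of_border_eq hx))
  unfold writeInactive
  rw [Code.wp]
  refine Code.wp_mono (wp_absorb hM hW hI hb) ?_
  rintro ψ ⟨I₁, H₁, hΔ, L₁, r₁⟩
  rw [Code.wp]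
  refine Code.wp_mono (wp_activate hM hW I₁ hx
    (by rw [r₁ 6 (by omega) (by omega), h6]) rfl H₁ hΔ fun _ k hk => hA (.inr ⟨k, L₁ x k hk⟩)) ?_
  rintro φ ⟨I₂, A₂, r₂⟩
  have e6 : φ.reg 6 = x := by rw [r₂ 6 (by omega), r₁ 6 (by omega) (by omega), h6]
  have e1 : φ.reg 1 = x + s * M := by rw [r₂ 1 (by omega), r₁ 1 (by omega) (by omega), h1]
  have e2 : φ.reg 2 = σ.reg 2 := by rw [r₂ 2 (by omega), r₁ 2 (by omega) (by omega)]
  refine wp_locate hM hW I₂ hx hs e1 e6 ?_ ?_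
  · intro ω I₃ _ r₃ hl
    refine Code.wp_mono
      (wp_setCell hM I₃ (by omega) ((r₃ 6 (by omega)).trans e6) hx hs rfl hl) ?_
    rintro χ ⟨I₄, -⟩
    rw [r₃ 2 (by omega), e2] at I₄
    exact ⟨b + 1, Δ, I₄.header, I₄.repr⟩
  · intro ω I₃ hm₃ _ hA'
    rw [hm₃] at hA'
    exact (hA' A₂).elim

theorem wp_writeCode {w : ℕ} (hn : 1 ≤ n) (hW : n ≤ 2 ^ w) (h0 : σ.reg 0 = n - 1)
    (h1 : σ.reg 1 < n) (hM : (n - 1) / 4 = M) (hD : Represents M σ.bit σ.mem D) :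
    writeCode.wp n (2 ^ w)
      (fun τ => Represents M τ.bit τ.mem (Function.update D (σ.reg 1) (σ.reg 2))) σ := by
  have hM' : 4 * M < n := by omega
  refine wp_withBlocks hn hW h0 hM hD ?_ ?_
  · intro τ x s b Δ hI hm r1 r2 r6 hx hs e
    refine wp_locate hM' hW hI hx hs (by rw [r1, e]) r6 ?_ ?_
    · intro υ hI' hm' r hl
      refine Code.wp_mono (wp_setCell hM' hI' (by omega) ((r 6 (by omega)).trans r6) hx hs rfl hl) ?_
      rintro ψ ⟨hI'', -⟩
      rw [r 2 (by omega), r2, ← e] at hI''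
      exact ⟨b, Δ, hI''.header, hI''.repr⟩
    · intro υ hI' hm' r hA
      rw [e, ← r2, ← r 2 (by omega)]
      exact wp_writeInactive hM' hW hI' hx hs (by rw [r 1 (by omega), r1, e])
        (by rw [r 6 (by omega), r6]) hA
  · intro τ hi hm hb r1 r2
    simp only [Code.wp, r1, r2]
    refine ⟨h1, ?_⟩
    rw [State.put_bit, State.put_mem, hb, hm]
    exact hD.update_rest hi

theorem wp_decr {Q : State → Prop} (h8 : σ.reg 8 = 0) (h9 : 0 < σ.reg 10 → σ.reg 9 = 1)
    (h : Q (σ.set 10 (σ.reg 10 - 1))) : decr.wp n W Q σ := by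
  simp only [decr, Code.wp, Test.HoldsIn, h8]
  constructor
  · intro h₁
    rw [h9 h₁]
    exact ⟨h₁, h⟩
  · intro h₁
    have : σ.set 10 (σ.reg 10 - 1) = σ := by
      ext k
      · rw [State.set_reg]; split_ifs with hk
        · subst hk; omega
        · rfl
      · rfl
      · rfl
    rwa [this] at h

/-- With border `1`, block `0` can lend only to the block it points to, the last one. So only the
last block is active, and its four entries are explicit; `2 ≤ M` makes it differ from block `0`. -/
theorem represents_filled {v : ℕ} (hM : 2 ≤ M) (h0 : g 0 = M - 1) (h₁ : g M = v)
    (h₂ : g (2 * M) = v) (h₃ : g (3 * M) = v) (k₀ : g (M - 1) = 0) (k₁ : g (2 * M - 1) = 1)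
    (k₂ : g (3 * M - 1) = v) (k₃ : g (4 * M - 1) = v) :
    Represents M false g fun j => if j < 4 * M then v else g j := by
  have hL : ∀ i k, Linked M 1 g i k → i = M - 1 ∧ k = 0 := by
    rintro i k ⟨h₁, h₂, h₃, h₄, h₅⟩
    obtain rfl : k = 0 := by omega
    omega
  have hL' : Linked M 1 g (M - 1) 0 := ⟨by omega, by omega, by omega, k₀, h0⟩
  refine ⟨1, v, .inr ⟨rfl, by omega, ⟨0, hL'⟩, k₁, k₂⟩, ?_, fun x s hx hs _ => if_pos (slot_lt hx hs)⟩
  rintro j a (⟨h, rfl⟩ | ⟨x, s, h, hs, rfl, rfl⟩ | ⟨x, k, h, rfl, rfl⟩ |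
    ⟨x, k, s, h, h1, hs, rfl, rfl⟩)
  · rw [if_neg (by omega)]
  · obtain rfl : x = 0 := by have := h.1; omega
    exact (h.2 _ hL').elim
  · obtain ⟨rfl, rfl⟩ := hL _ _ h
    rw [if_pos (by omega), show M - 1 + 3 * M = 4 * M - 1 by omega, k₃]
  · obtain ⟨rfl, rfl⟩ := hL _ _ h
    rw [if_pos (slot_lt h.2.1 hs), zero_add]
    interval_cases s
    · rw [one_mul, h₁]
    · rw [h₂]
    · rw [h₃]

/-- At most four cells lie outside the blocks. Counting down from `n - 1` stops at `0`, so for tiny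
`n` some stores merely repeat. -/
theorem wp_fillFixed {v : ℕ} (hn : n ≤ 4 * M + 4) (hM : 4 * M < n) (hW : n ≤ W)
    (h0 : σ.reg 0 = n - 1) (h2 : σ.reg 2 = v) (h3 : σ.reg 3 = M) (h8 : σ.reg 8 = 0)
    (h9 : 1 < n → σ.reg 9 = 1) :
    fillFixed.wp n W (fun τ => (∀ k < 10, τ.reg k = σ.reg k) ∧ ∀ j < n,
      (4 * M ≤ j ∨ j = 0 ∨ j = M ∨ j = 2 * M ∨ j = 3 * M) → τ.mem j = v) σ := by
  simp only [fillFixed, Code.wp, State.set_reg, Nat.reduceEqDiff, reduceIte, h0, h2]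
  refine ⟨by omega, wp_decr (by simpa using h8) (fun h => ?_) ?_⟩
  · simp only [State.put_reg, State.set_reg, Nat.reduceEqDiff, reduceIte] at h ⊢
    exact h9 (by omega)
  simp only [State.set_reg, State.put_reg, Nat.reduceEqDiff, reduceIte, h2]
  refine ⟨by omega, wp_decr (by simpa using h8) (fun h => ?_) ?_⟩
  · simp only [State.put_reg, State.set_reg, Nat.reduceEqDiff, reduceIte] at h ⊢
    exact h9 (by omega)
  simp only [State.set_reg, State.put_reg, Nat.reduceEqDiff, reduceIte, h2]
  refine ⟨by omega, wp_decr (by simpa using h8) (fun h => ?_) ?_⟩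
  · simp only [State.put_reg, State.set_reg, Nat.reduceEqDiff, reduceIte] at h ⊢
    exact h9 (by omega)
  simp only [State.set_reg, State.put_reg, Nat.reduceEqDiff, reduceIte, h2, h3, h8, State.set_mem,
    State.put_mem]
  refine ⟨by omega, by omega, by omega, by omega, by omega, by omega, by omega,
    fun k hk => ?_, fun j hj h => ?_⟩
  · simp [show k ≠ 11 by omega, show k ≠ 10 by omega]
  · simp only [Function.update_apply]
    split_ifs <;> first | rfl | omega

theorem wp_linkFirst {v : ℕ} (hM : 2 ≤ M) (hMn : 4 * M < n) (hW : n ≤ W) (h2 : σ.reg 2 = v)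
    (h3 : σ.reg 3 = M) (h8 : σ.reg 8 = 0) (h9 : σ.reg 9 = 1)
    (hv : ∀ j < n, (4 * M ≤ j ∨ j = 0 ∨ j = M ∨ j = 2 * M ∨ j = 3 * M) → σ.mem j = v) :
    linkFirst.wp n W (fun τ => ∃ D, Represents M τ.bit τ.mem D ∧ ∀ j < n, D j = v) σ := by
  simp only [linkFirst, Code.wp, State.set_reg, State.put_reg, Nat.reduceEqDiff, reduceIte, h2, h3,
    h8, h9, State.set_mem, State.put_mem, State.mark_bit, State.mark_mem]
  have e₁ : M - 1 + M = 2 * M - 1 := by omega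
  have e₂ : 2 * M - 1 + M = 3 * M - 1 := by omega
  have e₃ : 3 * M - 1 + M = 4 * M - 1 := by omega
  rw [e₁, e₂, e₃]
  refine ⟨by omega, by omega, by omega, by omega, by omega, by omega, by omega, by omega, by omega,
    _, represents_filled (v := v) hM ?_ ?_ ?_ ?_ ?_ ?_ ?_ ?_, fun j hj => ?_⟩
  all_goals simp only [Function.update_apply]
  · split_ifs <;> omega
  · have := hv M (by omega) (by omega)
    split_ifs <;> omega
  · have := hv (2 * M) (by omega) (by omega)
    split_ifs <;> omega
  · have := hv (3 * M) (by omega) (by omega)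
    split_ifs <;> omega
  · split_ifs <;> omega
  · split_ifs <;> omega
  · split_ifs <;> omega
  · split_ifs <;> omega
  · have := hv j hj
    split_ifs <;> omega

theorem wp_fillCode {w : ℕ} (hn : 1 ≤ n) (hW : n ≤ 2 ^ w) (h0 : σ.reg 0 = n - 1)
    (hM : (n - 1) / 4 = M) :
    fillCode.wp n (2 ^ w)
      (fun τ => ∃ D, Represents M τ.bit τ.mem D ∧ ∀ j < n, D j = σ.reg 2) σ := by
  have hM' : 4 * M < n := by omega
  have hn' : n ≤ 4 * M + 4 := by omega
  have h1 : 1 < n → 1 % 2 ^ w = 1 := fun h => Nat.mod_eq_of_lt (by omega)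
  simp only [fillCode, loadBlocks, Code.wp, State.set_reg, Nat.reduceEqDiff, reduceIte, h0,
    div_const hW, hM, Nat.zero_mod]
  refine Code.wp_mono (wp_fillFixed (v := σ.reg 2) hn' hM' hW (by simpa using h0) (by simp)
    (by simp) (by simp) fun h => ?_) ?_
  · rw [State.set_reg, if_pos rfl]; exact h1 h
  rintro τ ⟨hr, hv⟩
  have r2 : τ.reg 2 = σ.reg 2 := by rw [hr 2 (by omega)]; simp
  have r3 : τ.reg 3 = M := by rw [hr 3 (by omega)]; simp
  have r8 : τ.reg 8 = 0 := by rw [hr 8 (by omega)]; simp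
  have r9 : 1 < n → τ.reg 9 = 1 := by
    intro h
    rw [hr 9 (by omega), State.set_reg, if_pos rfl]; exact h1 h
  have r9' : n = 1 → M = 0 := by omega
  simp only [Test.HoldsIn, r3]
  -- If `M ≤ 1`, the cells of block `0` and the remaining ones are all the cells, so `fillFixed` has
  -- already overwritten everything.
  refine ⟨fun h => ?_, fun h => ⟨_, represents_true, fun j hj => ?_⟩⟩
  · exact wp_linkFirst (by omega) hM' hW r2 r3 r8 (r9 (by omega)) hv
  · refine hv j hj ?_
    by_cases h' : 1 < n
    · have := r9 h'; omega
    · omega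

end

/-! ### The implementation and its runs -/

/-- Fillable arrays by chained blocks. -/
def chainedBlocks : Implementation where
  setup := (Code.setBit true).compile
  read := readCode.compile
  write := writeCode.compile
  fill := fillCode.compile

/-- A time bound for all operations of `chainedBlocks`. -/
def timeBound : ℕ := 1 + readCode.cost + writeCode.cost + fillCode.cost

/-- The memory represents an array that agrees with `A` where `A` is defined. -/
def Store.Represents {n w : ℕ} (m : Store n w) (A : Fin n → Option (BitVec w)) : Prop :=
  ∃ D : ℕ → ℕ, FillableArray.Represents ((n - 1) / 4) m.bit
    (fun a => if h : a < n then (m.cells ⟨a, h⟩).toNat else 0) D ∧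
      ∀ i v, A i = some v → D i = v.toNat

variable {n w : ℕ}

theorem startRegs_zero (hn : 1 ≤ n) (hw : n ≤ 2 ^ w) (op : Op n w) :
    (op.startRegs 0).toNat = n - 1 := by
  have e : op.startRegs 0 = BitVec.ofNat w (n - 1) := by cases op <;> rfl
  rw [e, BitVec.toNat_ofNat, Nat.mod_eq_of_lt (by omega)]

theorem toNat_index (hw : n ≤ 2 ^ w) (i : Fin n) : (BitVec.ofNat w i.val).toNat = i :=  by
  rw [BitVec.toNat_ofNat, Nat.mod_eq_of_lt (by omega)]

theorem exists_exec (F : Equiv.Perm (Fin n)) (hn : 1 ≤ n) (hw : n ≤ 2 ^ w) (op : Op n w)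
    {m : Store n w} {A : Fin n → Option (BitVec w)} (hA : m.Represents A) :
    ∃ t c, Exec F (chainedBlocks.prog op) ⟨op.startRegs, m⟩ t c ∧ t ≤ timeBound ∧
      c.store.Represents (op.apply A) ∧ ∀ i v, op = .read i → A i = some v → c.regs 0 = v := by
  obtain ⟨D, hD, hDA⟩ := hA
  have h0 := startRegs_zero hn hw op
  cases op with
  | read i =>
    have e1 : ((Op.read i : Op n w).startRegs 1).toNat = i := toNat_index hw i
    obtain ⟨t, c, h, ht, hR, hc⟩ := Code.exec_of_wp F
      (c := ⟨(Op.read i : Op n w).startRegs, m⟩)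
      (wp_readCode (σ := Config.view ⟨(Op.read i : Op n w).startRegs, m⟩) hn hw h0
        (lt_of_eq_of_lt e1 i.2) rfl hD)
    refine ⟨t, c, h, ht.trans (by unfold timeBound; omega), ⟨D, hR, hDA⟩, ?_⟩
    intro i' v hi hv
    cases hi
    apply BitVec.eq_of_toNat_eq
    rw [← hDA i v hv, ← e1]
    exact hc
  | write i Δ =>
    have e1 : ((Op.write i Δ).startRegs 1).toNat = i := toNat_index hw i
    obtain ⟨t, c, h, ht, hR⟩ := Code.exec_of_wp F (c := ⟨(Op.write i Δ).startRegs, m⟩)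
      (wp_writeCode (σ := Config.view ⟨(Op.write i Δ).startRegs, m⟩) hn hw h0
        (lt_of_eq_of_lt e1 i.2) rfl hD)
    refine ⟨t, c, h, ht.trans (by unfold timeBound; omega), ⟨_, hR, fun j v hj => ?_⟩,
      fun _ _ h => by cases h⟩
    change Function.update D ((Op.write i Δ).startRegs 1).toNat Δ.toNat j = _
    rw [e1]
    simp only [Op.apply, Function.update_apply, Fin.ext_iff] at hj ⊢
    split_ifs at hj ⊢ with hij
    · rw [Option.some.inj hj]
    · exact hDA j v hj
  | fill Δ =>
    obtain ⟨t, c, h, ht, D', hR, hD'⟩ := Code.exec_of_wp F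
      (c := ⟨(Op.fill Δ : Op n w).startRegs, m⟩)
      (wp_fillCode (σ := Config.view ⟨(Op.fill Δ : Op n w).startRegs, m⟩) hn hw h0 rfl)
    refine ⟨t, c, h, ht.trans (by unfold timeBound; omega), ⟨D', hR, fun j v hj => ?_⟩,
      fun _ _ h => by cases h⟩
    rw [hD' j j.2, ← Option.some.inj hj]
    rfl

theorem exists_steps (F : Equiv.Perm (Fin n)) (hn : 1 ≤ n) (hw : n ≤ 2 ^ w) (ops : List (Op n w))
    {m : Store n w} {A : Fin n → Option (BitVec w)} (hA : m.Represents A) :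
    ∃ (store : ℕ → Store n w) (time : ℕ → ℕ) (answer : ℕ → BitVec w), store 0 = m ∧
      ∀ (j : ℕ) (hj : j < ops.length),
        (∃ c : Config n w, Exec F (chainedBlocks.prog ops[j]) ⟨ops[j].startRegs, store j⟩ (time j) c ∧
          c.store = store (j + 1) ∧ c.regs 0 = answer j) ∧
        time j ≤ timeBound ∧
        ∀ i v, ops[j] = .read i → (ops.take j).foldl Op.apply A i = some v → answer j = v := by
  induction ops generalizing m A with
  | nil => exact ⟨fun _ => m, fun _ => 0, fun _ => 0, rfl, fun j hj => absurd hj (by simp)⟩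
  | cons op ops ih =>
    obtain ⟨t, c, hc, ht, hA', hv⟩ := exists_exec F hn hw op hA
    obtain ⟨store, time, answer, h0, h⟩ := ih hA'
    refine ⟨fun j => j.casesOn m store, fun j => j.casesOn t time,
      fun j => j.casesOn (c.regs 0) answer, rfl, ?_⟩
    rintro (_ | j) hj
    · exact ⟨⟨c, hc, h0.symm, rfl⟩, ht, hv⟩
    · exact h j (by simpa using hj)

/-- Every operation of `chainedBlocks`, a `write` included, takes constant time in the worst case,
whatever the oracle; the bound on the expected time of a `write` is a consequence. -/
theorem exists_run (F : Equiv.Perm (Fin n)) (hn : 1 ≤ n) (hw : n ≤ 2 ^ w) (m₀ : Store n w)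
    (ops : List (Op n w)) :
    ∃ ρ : Run n w, ρ.IsRunOf chainedBlocks F m₀ ops ∧ ρ.Correct ops ∧ ρ.setupTime ≤ timeBound ∧
      ∀ j < ops.length, ρ.time j ≤ timeBound := by
  -- Once the bit is set, arbitrary initial cells represent the array that they literally contain,
  -- which is consistent with no entry being set.
  obtain ⟨store, time, answer, h0, h⟩ := exists_steps F hn hw ops
    (m := { m₀ with bit := true }) (A := fun _ => none)
    ⟨_, represents_true, fun _ _ h => by cases h⟩
  refine ⟨⟨1, store, time, answer⟩, ⟨⟨_, .instr _ _, h0.symm⟩, fun j hj => (h j hj).1⟩,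
    fun j hj i v hi hv => (h j hj).2.2 i v hi hv, by unfold timeBound; dsimp only; omega,
    fun j hj => (h j hj).2.1⟩

end FillableArray

theorem theorem2 :
    ∃ (D : FillableArray.Implementation) (K : ℕ),
      ∀ (n w : ℕ), 1 ≤ n → n ≤ 2 ^ w →
        ∀ (m₀ : FillableArray.Store n w) (ops : List (FillableArray.Op n w)),
          ∃ ρ : Equiv.Perm (Fin n) → FillableArray.Run n w,
            (∀ F : Equiv.Perm (Fin n),
              (ρ F).IsRunOf D F m₀ ops ∧ (ρ F).Correct ops ∧ (ρ F).setupTime ≤ K ∧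
                ∀ (j : ℕ) (hj : j < ops.length), ¬ ops[j].IsWrite → (ρ F).time j ≤ K) ∧
            ∀ μ : PMF (Equiv.Perm (Fin n)),
              FillableArray.IsAlmostKWiseIndependent 2 (1 / (n : ℝ) ^ 2) μ →
                ∀ (j : ℕ) (hj : j < ops.length), ops[j].IsWrite →
                  ∑ F : Equiv.Perm (Fin n), (μ F).toReal * ((ρ F).time j : ℝ) ≤ (K : ℝ) := by
  refine ⟨FillableArray.chainedBlocks, FillableArray.timeBound, fun n w hn hw m₀ ops => ?_⟩
  choose ρ h₁ h₂ h₃ h₄ using fun F => FillableArray.exists_run F hn hw m₀ ops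
  refine ⟨ρ, fun F => ⟨h₁ F, h₂ F, h₃ F, fun j hj _ => h₄ F j hj⟩, fun μ _ j hj _ => ?_⟩
  -- The weights sum to one, so the bound that holds for every `F` passes to the expectation.
  have hμ : ∑ F, (μ F).toReal = 1 := by
    rw [← ENNReal.toReal_sum fun F _ => μ.apply_ne_top F, ← tsum_fintype (L := .unconditional _), μ.tsum_coe,
      ENNReal.toReal_one]
  calc ∑ F, (μ F).toReal * ((ρ F).time j : ℝ)
      ≤ ∑ F, (μ F).toReal * (FillableArray.timeBound : ℝ) :=
        Finset.sum_le_sum fun F _ => mul_le_mul_of_nonneg_left (Nat.cast_le.2 (h₄ F j hj))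
          ENNReal.toReal_nonneg
    _ = FillableArray.timeBound := by rw [← Finset.sum_mul, hμ, one_mul]
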